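/- Let $q,t$ be indeterminates. For $\sigma\in S_n$ put $\mathrm{maj}(\sigma)=\sum_{1\le i\le n-1,\ \sigma(i)>\sigma(i+1)} i$ and $\mathrm{exc}(\sigma)=|\{i\in\{1,\dots,n\}:\sigma(i)>i\}|$. For $n\ge 1$ let $A_n^{\mathrm{maj},\mathrm{exc}}(q,t)=\sum_{\sigma\in S_n}q^{\mathrm{maj}(\sigma)}t^{\mathrm{exc}(\sigma)}$, and let $A_0^{\mathrm{maj},\mathrm{exc}}(q,t)=1$. Let $[n]_q=1+q+\cdots+q^{n-1}$, let $[n]_q!=\prod_{j=1}^n[j]_q$ (so $[0]_q!=1$), and let $\exp_q(z)=\sum_{n\ge 0}z^n/[n]_q!$. Then, as formal power series in $z$ over the field $\mathbb{Q}(q,t)$, $$\sum_{n\ge 0}A_n^{\mathrm{maj},\mathrm{exc}}(q,t)\,\frac{z^n}{[n]_q!}=\frac{(1-tq)\exp_q(z)}{\exp_q(ztq)-tq\,\exp_q(z)},$$ where every $[n]_q!$ is nonzero and the power series in the denominator on the right is invertible. -/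

import Mathlib

open PowerSeries

noncomputable section

namespace MajExc

/-- The descent set of a permutation of `n` letters. The letters `1, …, n` are the elements
`0, …, n - 1` of `Fin n`, so `i : Fin n` stands for the position `i + 1`. The position of `i` is a
descent if there is a next position `j` and the value at `j` is smaller than the value at `i`. -/
def desSet {n : ℕ} (σ : Equiv.Perm (Fin n)) : Finset (Fin n) :=
  {i : Fin n | ∃ j : Fin n, (j : ℕ) = (i : ℕ) + 1 ∧ σ j < σ i}

/-- The excedance set of a permutation of `n` letters (the last position is never in it). -/
def excSet {n : ℕ} (σ : Equiv.Perm (Fin n)) : Finset (Fin n) :=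
  {i : Fin n | i < σ i}

/-- The major index: the sum of the descent positions, counted from `1`. -/
def maj {n : ℕ} (σ : Equiv.Perm (Fin n)) : ℕ :=
  ∑ i ∈ desSet σ, ((i : ℕ) + 1)

/-- The excedance number. -/
def exc {n : ℕ} (σ : Equiv.Perm (Fin n)) : ℕ :=
  (excSet σ).card

/-- The joint distribution `A_n^{maj,exc}(q,t) = ∑_{σ ∈ S_n} q^{maj σ} t^{exc σ}`;
its value for `n = 0` is `1`. -/
def jointPoly {R : Type*} [CommSemiring R] (n : ℕ) (q t : R) : R :=
  ∑ σ : Equiv.Perm (Fin n), q ^ maj σ * t ^ exc σ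

/-- `[n]_q = 1 + q + ⋯ + q^(n-1)`. -/
def qInt {R : Type*} [CommSemiring R] (q : R) (n : ℕ) : R :=
  ∑ i ∈ Finset.range n, q ^ i

/-- `[n]_q! = [1]_q [2]_q ⋯ [n]_q`. -/
def qFact {R : Type*} [CommSemiring R] (q : R) (n : ℕ) : R :=
  ∏ j ∈ Finset.Icc 1 n, qInt q j

/-- `exp_q(z) = ∑_{n ≥ 0} z^n / [n]_q!`, a formal power series in `z`. The series `exp_q(z a)` is
`PowerSeries.rescale a (expq q)`. -/
def expq {K : Type*} [Field K] (q : K) : K⟦X⟧ :=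
  PowerSeries.mk fun n => 1 / qFact q n

/-- The field `ℚ(q, t)` of rational functions in two indeterminates. -/
abbrev RatQT : Type := FractionRing (MvPolynomial (Fin 2) ℚ)

/-- The indeterminate `q`. -/
def qVar : RatQT := algebraMap (MvPolynomial (Fin 2) ℚ) RatQT (MvPolynomial.X 0)

/-- The indeterminate `t`. -/
def tVar : RatQT := algebraMap (MvPolynomial (Fin 2) ℚ) RatQT (MvPolynomial.X 1)

end MajExc

end

/-! Divide $A_n$ by $\prod_{i\le n}(1-q^i)$. The quotient $f_n$ is the sum of $q^{\sum
c}t^{\mathrm{exc}(\sigma)}$ over pairs $(\sigma,c)$ in which $c$ is weakly decreasing and $\sigma$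
increases where $c$ is constant: for fixed $\sigma$ the gaps of $c$ are free apart from a forced
unit at each descent, which produces $q^{\mathrm{maj}}$ (`tsum_compat`). In such a pair, $i$ is an
excedance exactly when the letters of $c$ read along the orbit of $i$ first change by a drop
(`Compat.drops_iff`). Hence exc depends only on these itineraries. A labelled form of the
Gessel–Reutenauer correspondence compares fibres over a family of itineraries
(`nonempty_fiber_equiv`) and shows that $n!\,f_n$ is a sum over all permutations with arbitrary
letters attached to the points (`factorial_mul_tsum_compat`).

There the condition linking letters and permutation is gone. If no letter is 0, all letters can be
lowered by 1. Otherwise, rearranging the arrows that enter points with letter 0 preserves the number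
of drops, so one may root at a 0 that is alone on its cycle (`sum_pow_wexc`,
`total_eq_add_sum_rooted`). Removing that cycle gives $f_{n+1}=q^{n+1}f_{n+1}+\sum_k q^kD_kf_{n-k}$,
where $D_k$ counts words of length $k$ by drops (`recursion_of_total`). Cutting words at their first
0 gives a quadratic recursion for $D_k$ (`dropSum_recursion`).

For the generating functions $F$ and $V$ of $f_n$ and $D_k$ these are $q$-difference equations. The
one for $V$ is of Riccati type, becomes linear in $1/V$, and is solved with $H=\sum z^n/\prod_{i\le
n}(1-q^i)$, for which $H(qz)=(1-z)H(z)$ (`series_identity`). Replacing $z$ by $(1-q)z$ turns $H$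
into $\exp_q$.

The counting takes place in `ℝ≥0∞`, where sums always converge and may be reordered. It yields the
identity for real $0\le q<1$, $0\le t\le 1$; algebraically independent $q,t\in(0,1)$ embed
$\mathbb{Q}(q,t)$ in $\mathbb{R}$ and carry the identity back (`exists_ringHom_real`). -/

noncomputable section

namespace MajExc

open Equiv

/-! ### Itineraries and their dual lexicographic order. -/

/-- The letters `w x, w (f x), w (f (f x)), …` read along the orbit of `x`. -/
def itin {α : Type*} (f : α → α) (w : α → ℕ) (x : α) : ℕ → ℕ := fun j => w (f^[j] x)

/-- The sequence without its first letter. -/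
def shift (s : ℕ → ℕ) : ℕ → ℕ := fun j => s (j + 1)

/-- The first letter that differs from the initial one is smaller. -/
def Drops (s : ℕ → ℕ) : Prop := ∃ j, s j < s 0 ∧ ∀ i < j, s i = s 0

/-- The sequence as an element of the dual lexicographic order. -/
def key (s : ℕ → ℕ) : (Lex (ℕ → ℕ))ᵒᵈ := OrderDual.toDual (toLex s)

lemma apply_inv_apply {α : Type*} (σ : Perm α) (x : α) : σ (σ⁻¹ x) = x := σ.apply_symm_apply x

lemma key_injective : Function.Injective key := fun _ _ h => h

lemma key_lt_key {a b : ℕ → ℕ} :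
    key b < key a ↔ ∃ i, (∀ j < i, a j = b j) ∧ a i < b i := Iff.rfl

lemma head_le_of_key_le {a b : ℕ → ℕ} (h : key a ≤ key b) : b 0 ≤ a 0 := by
  by_contra! hlt
  exact absurd h (not_le_of_gt (key_lt_key.2 ⟨0, by simp, hlt⟩))

lemma key_shift_le {a b : ℕ → ℕ} (h : key a ≤ key b) (h0 : a 0 = b 0) :
    key (shift a) ≤ key (shift b) := by
  by_contra! hlt
  obtain ⟨i, hi, hlt⟩ := key_lt_key.1 hlt
  refine absurd h (not_le_of_gt (key_lt_key.2 ⟨i + 1, ?_, hlt⟩))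
  rintro (_ | j) hj
  · exact h0
  · exact hi j (by omega)

section

variable {α : Type*}

lemma itin_apply_zero (f : α → α) (w : α → ℕ) (x : α) : itin f w x 0 = w x := rfl

lemma itin_map (f : α → α) (w : α → ℕ) (x : α) : itin f w (f x) = shift (itin f w x) := rfl

lemma itin_eq_of_shift {f : α → α} {T : α → ℕ → ℕ} (h : ∀ x, T (f x) = shift (T x)) :
    itin f (fun x => T x 0) = T := by
  funext x j
  induction j generalizing x with
  | zero => rfl
  | succ j ih =>
    have := ih (f x)
    rw [h x] at this
    exact this

lemma itin_conj {β : Type*} (e : α ≃ β) (f : α → α) (w : β → ℕ) (y : β) :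
    itin (e ∘ f ∘ e.symm) w y = itin f (w ∘ e) (e.symm y) := by
  funext j
  have : Function.Semiconj e f (e ∘ f ∘ e.symm) := fun x => by simp
  have h := (this.iterate_right j) (e.symm y)
  simp only [itin, Function.comp_apply, h, Equiv.apply_symm_apply]

end

/-! ### Compatible pairs are determined by their itineraries. -/

/-- `c` is weakly decreasing, and `σ` is increasing where `c` is constant. -/
def Compat {n : ℕ} (σ : Perm (Fin n)) (c : Fin n → ℕ) : Prop :=
  Antitone c ∧ ∀ i j, i < j → c i = c j → σ i < σ j

section

variable {n : ℕ}

/-- As long as the letters along the two orbits agree, $\sigma$ keeps the iterates in their order;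
at the first disagreement the smaller point therefore has the larger letter. -/
lemma Compat.monotone_key {σ : Perm (Fin n)} {c : Fin n → ℕ} (h : Compat σ c) :
    Monotone (key ∘ itin σ c) := by
  refine monotone_iff_forall_lt.2 fun i j hij => ?_
  by_contra! hlt
  obtain ⟨m, hm, hlt⟩ := key_lt_key.1 hlt
  have key : ∀ k ≤ m, σ^[k] i < σ^[k] j := by
    intro k hk
    induction k with
    | zero => exact hij
    | succ k ih =>
      rw [Function.iterate_succ_apply', Function.iterate_succ_apply']
      exact h.2 _ _ (ih (by omega)) (hm k (by omega))
  exact absurd (h.1 (key m le_rfl).le) (not_le_of_gt hlt)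

/-- This recovers $\sigma$ from the itineraries alone. `Tuple.sort` is stable, and the clause of
`Compat` about equal letters is precisely its tie-breaking rule. -/
lemma Compat.inv_eq_sort {σ : Perm (Fin n)} {c : Fin n → ℕ} (h : Compat σ c) :
    σ⁻¹ = Tuple.sort (key ∘ shift ∘ itin σ c) := by
  have hs : ∀ i, shift (itin σ c (σ⁻¹ i)) = itin σ c i := fun i => by
    rw [← itin_map, apply_inv_apply]
  rw [Tuple.eq_sort_iff]
  constructor
  · have : (key ∘ shift ∘ itin σ c) ∘ ⇑σ⁻¹ = key ∘ itin σ c := by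
      funext i
      exact congrArg key (hs i)
    rw [this]
    exact h.monotone_key
  · intro i j hij he
    simp only [Function.comp_apply, hs] at he
    have he := key_injective he
    have hc : c (σ⁻¹ i) = c (σ⁻¹ j) := by
      -- Orbits are periodic, so the letter preceding $x$ can be read at the end of a full period of
      -- its itinerary.
      have h1 : ∀ x : Fin n, itin σ c x (orderOf σ - 1) = c (σ⁻¹ x) := fun x => by
        have h2 : (σ : Fin n → Fin n)^[orderOf σ] (σ⁻¹ x) = σ⁻¹ x := by
          rw [← Perm.coe_pow, pow_orderOf_eq_one]; rfl
        obtain ⟨m, hm⟩ : ∃ m, orderOf σ = m + 1 :=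
          Nat.exists_eq_succ_of_ne_zero (orderOf_pos σ).ne'
        rw [hm, Function.iterate_succ_apply, apply_inv_apply] at h2
        rw [hm, Nat.add_sub_cancel, itin, h2]
      rw [← h1, ← h1, he]
    by_contra! hle
    rcases hle.lt_or_eq with hlt | heq
    · have := h.2 _ _ hlt hc.symm
      rw [apply_inv_apply, apply_inv_apply] at this
      exact absurd hij (not_lt_of_gt this)
    · exact hij.ne (σ⁻¹.injective heq).symm

/-- Because of $\tau$, the shifted itineraries are a rearrangement of the original ones, so sorting
them gives back the sorted family `T`. The inverse of the stable sorting permutation thus shifts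
`T`, and stability makes it compatible with the first letters. -/
lemma exists_compat {T : Fin n → ℕ → ℕ} (hT : Monotone (key ∘ T)) {τ : Perm (Fin n)}
    (hτ : ∀ x, T (τ x) = shift (T x)) :
    ∃ σ : Perm (Fin n), ∃ c, Compat σ c ∧ itin σ c = T := by
  set κ := Tuple.sort (key ∘ shift ∘ T) with hκ
  obtain ⟨hmono, hstab⟩ := Tuple.eq_sort_iff.1 hκ
  have hTκ : ∀ i, shift (T (κ i)) = T i := by
    have h1 : (key ∘ shift ∘ T) ∘ κ = (key ∘ T) ∘ ⇑(τ * κ) := by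
      funext i; simp [hτ]
    have h2 : (key ∘ T) ∘ ⇑(τ * κ) = (key ∘ T) ∘ ⇑(1 : Perm (Fin n)) :=
      Tuple.unique_monotone (h1 ▸ hmono) (by simpa using hT)
    intro i
    exact key_injective (congrFun (h1.trans h2) i)
  have hσ : ∀ i, T (κ⁻¹ i) = shift (T i) := fun i => by
    rw [← hTκ (κ⁻¹ i), apply_inv_apply]
  refine ⟨κ⁻¹, fun x => T x 0, ⟨fun i j hij => head_le_of_key_le (hT hij), ?_⟩,
    itin_eq_of_shift hσ⟩
  intro i j hij hc
  have hle := key_shift_le (hT hij.le) hc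
  rw [← hσ, ← hσ] at hle
  by_contra! hle'
  have heq : T (κ⁻¹ i) = T (κ⁻¹ j) := key_injective (le_antisymm hle (hT hle'))
  rcases hle'.lt_or_eq with hlt | he
  · have := hstab _ _ hlt (by simpa [hσ, ← hσ i, ← hσ j] using congrArg key heq.symm)
    rw [apply_inv_apply, apply_inv_apply] at this
    exact absurd hij (not_lt_of_gt this)
  · exact hij.ne (κ⁻¹.injective he).symm

/-- Sorted and labelled structures with prescribed itineraries are equinumerous. -/
lemma nonempty_fiber_equiv (T : Fin n → ℕ → ℕ) :
    Nonempty ({x : {p : Perm (Fin n) × (Fin n → ℕ) // Compat p.1 p.2} × Perm (Fin n) //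
        itin x.1.1.1 x.1.1.2 ∘ x.2 = T} ≃
      {y : Perm (Fin n) × (Fin n → ℕ) // itin y.1 y.2 = T}) := by
  -- If some permutation shifts `T`, both sides are parametrized by the stabilizer of `T`: on the
  -- left the compatible pair is unique and only its labelling varies; on the right the letters are
  -- fixed and any two shifting permutations differ by a stabilizer element. Otherwise both sides
  -- are empty.
  by_cases hT : ∃ τ : Perm (Fin n), ∀ x, T (τ x) = shift (T x)
  · obtain ⟨τ, hτ⟩ := hT
    set s := Tuple.sort (key ∘ T) with hs
    have hmono : Monotone (key ∘ (T ∘ s)) := Tuple.monotone_sort (key ∘ T)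
    obtain ⟨σ, c, hσc, hit⟩ := exists_compat (τ := s⁻¹ * τ * s) hmono fun x => by simp [hτ]
    have hS : ∀ ρ : {ρ : Perm (Fin n) // T ∘ ρ = T}, ∀ x, T (ρ.1 x) = T x :=
      fun ρ x => congrFun ρ.2 x
    let f : {ρ : Perm (Fin n) // T ∘ ρ = T} →
        {x : {p : Perm (Fin n) × (Fin n → ℕ) // Compat p.1 p.2} × Perm (Fin n) //
        itin x.1.1.1 x.1.1.2 ∘ x.2 = T} := fun ρ => ⟨(⟨(σ, c), hσc⟩, s⁻¹ * ρ.1), by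
          funext x; simp [hit, hS]⟩
    let g : {ρ : Perm (Fin n) // T ∘ ρ = T} →
        {y : Perm (Fin n) × (Fin n → ℕ) // itin y.1 y.2 = T} :=
      fun ρ => ⟨(ρ.1 * τ, fun x => T x 0), itin_eq_of_shift fun x => by simp [hS, hτ]⟩
    have hf : Function.Bijective f := by
      constructor
      · intro ρ ρ' h
        simpa [f, Subtype.ext_iff] using h
      · rintro ⟨⟨⟨⟨σ', c'⟩, h'⟩, g'⟩, hg⟩
        simp only at h' hg
        have h1 : itin σ' c' = T ∘ ⇑(g'⁻¹) := by
          rw [← hg]; funext x; simp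
        have h2 : itin σ' c' = itin σ c := by
          have h3 := h'.monotone_key
          rw [h1] at h3
          have h4 := Tuple.unique_monotone (f := key ∘ T) (σ := g'⁻¹) (τ := s) h3 hmono
          rw [hit, h1]
          funext x
          exact key_injective (congrFun h4 x)
        have hc : c' = c := by
          funext x
          exact congrFun (congrFun h2 x) 0
        have hσ : σ' = σ := by
          have h5 := h'.inv_eq_sort
          rw [h2, ← hσc.inv_eq_sort] at h5
          exact inv_injective h5
        subst hc hσ
        refine ⟨⟨s * g', ?_⟩, ?_⟩
        · rw [← hg, hit]
          funext x
          simp only [Function.comp_apply, Perm.mul_apply]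
          have := congrFun hg (s (g' x))
          have h6 := congrFun hit (g' x)
          simp only [Function.comp_apply] at this h6
          rw [← h6]
          have h7 := congrFun hit (g' (s (g' x)))
          simp only [Function.comp_apply] at h7
          rw [← h7, this, h6]
        · simp [f]
    have hg : Function.Bijective g := by
      constructor
      · intro ρ ρ' h
        simpa [g, Subtype.ext_iff] using h
      · rintro ⟨⟨τ', w⟩, h⟩
        simp only at h
        refine ⟨⟨τ' * τ⁻¹, ?_⟩, ?_⟩
        · funext x
          have h1 := itin_map τ' w (τ⁻¹ x)
          rw [h, ← hτ] at h1
          simpa using h1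
        · have : (fun x => T x 0) = w := by
            funext x; rw [← h]; rfl
          simp [g, this]
    exact ⟨(Equiv.ofBijective f hf).symm.trans (Equiv.ofBijective g hg)⟩
  · push Not at hT
    have h1 : ∀ y : Perm (Fin n) × (Fin n → ℕ), itin y.1 y.2 ≠ T := fun y hy => by
      obtain ⟨x, hx⟩ := hT y.1
      rw [← hy] at hx
      exact hx (itin_map _ _ _)
    have : IsEmpty {y : Perm (Fin n) × (Fin n → ℕ) // itin y.1 y.2 = T} := ⟨fun y => h1 _ y.2⟩
    have : IsEmpty {x : {p : Perm (Fin n) × (Fin n → ℕ) // Compat p.1 p.2} × Perm (Fin n) //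
        itin x.1.1.1 x.1.1.2 ∘ x.2 = T} := ⟨fun ⟨⟨⟨⟨σ, c⟩, hc⟩, g⟩, hx⟩ => by
          -- Transporting the pair along the labelling would give a permutation with itineraries
          -- `T`.
          refine h1 (g⁻¹ * σ * g, c ∘ g) ?_
          simp only at hx
          rw [← hx]
          funext x
          have := itin_conj (g⁻¹) σ (c ∘ g) x
          have h2 : (⇑(g⁻¹) ∘ ⇑σ ∘ ⇑(Equiv.symm g⁻¹)) = ⇑(g⁻¹ * σ * g) := by
            funext y; rfl
          have h3 : (c ∘ g) ∘ ⇑(g⁻¹) = c := by funext y; simp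
          rw [h2, h3] at this
          exact this⟩
    exact ⟨Equiv.equivOfIsEmpty _ _⟩

end

/-! ### Excedances as drops, and the labelled sum. -/

open ENNReal

section

variable {α : Type*} [Fintype α]

open Classical in
/-- The number of points whose itinerary drops. -/
def wexc (f : α → α) (w : α → ℕ) : ℕ := (Finset.univ.filter fun x => Drops (itin f w x)).card

end

section

variable {n : ℕ}

/-- While the letters stay constant, the direction of the first step persists. If $\sigma(i)\le i$,
the orbit descends weakly and the next letter cannot be smaller. If $i<\sigma(i)$, it climbs
strictly, so by finiteness the letter must change, and then it falls. -/
lemma Compat.drops_iff {σ : Perm (Fin n)} {c : Fin n → ℕ} (h : Compat σ c) (i : Fin n) :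
    Drops (itin σ c i) ↔ i < σ i := by
  constructor
  · rintro ⟨j, hj, hlt⟩
    by_contra! hi
    have key : ∀ m < j, σ^[m + 1] i ≤ σ^[m] i := by
      intro m hm
      induction m with
      | zero => exact hi
      | succ m ih =>
        have ih := ih (by omega)
        rw [Function.iterate_succ_apply' _ (m + 1)]
        nth_rw 2 [Function.iterate_succ_apply']
        rcases ih.lt_or_eq with h1 | h1
        · exact (h.2 _ _ h1 ((hlt (m + 1) hm).trans (hlt m (by omega)).symm)).le
        · rw [h1]
    obtain _ | m := j
    · exact absurd hj (lt_irrefl _)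
    · have h1 := h.1 (key m (by omega))
      have h2 := hlt m (by omega)
      simp only [itin] at h1 h2 hj
      omega
  · intro hi
    by_contra hD
    have key : ∀ m, (∀ k ≤ m, c (σ^[k] i) = c i) ∧ σ^[m] i < σ^[m + 1] i := by
      intro m
      induction m with
      | zero => exact ⟨fun k hk => by rw [Nat.le_zero.1 hk]; rfl, hi⟩
      | succ m ih =>
        have h1 : c (σ^[m + 1] i) ≤ c i := (ih.1 m le_rfl) ▸ h.1 ih.2.le
        have h2 : c (σ^[m + 1] i) = c i := by
          by_contra hne
          exact hD ⟨m + 1, lt_of_le_of_ne h1 hne, fun k hk => ih.1 k (by omega)⟩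
        refine ⟨fun k hk => ?_, ?_⟩
        · rcases Nat.lt_or_ge m k with h3 | h3
          · rwa [show k = m + 1 by omega]
          · exact ih.1 k h3
        · rw [Function.iterate_succ_apply' _ (m + 1)]
          nth_rw 1 [Function.iterate_succ_apply']
          exact h.2 _ _ ih.2 ((ih.1 m le_rfl).trans h2.symm)
    exact not_injective_infinite_finite _
      (strictMono_nat_of_lt_succ fun m => (key m).2).injective

lemma Compat.wexc_eq {σ : Perm (Fin n)} {c : Fin n → ℕ} (h : Compat σ c) :
    wexc σ c = exc σ := by
  classical
  unfold wexc exc excSet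
  congr 1
  ext i
  simp only [Finset.mem_filter_univ, h.drops_iff]

end

section

variable (q t : ℝ≥0∞)

/-- The weight of a permutation with letters attached to the points. -/
def weight {α : Type*} [Fintype α] (f : α → α) (w : α → ℕ) : ℝ≥0∞ :=
  q ^ (∑ x, w x) * t ^ wexc f w

/-- The weighted sum over all permutations of `α` with letters attached to the points. -/
def total (α : Type*) [Fintype α] [DecidableEq α] : ℝ≥0∞ :=
  ∑ τ : Perm α, ∑' w : α → ℕ, weight q t τ w

open Classical in
lemma weight_of_itin {α : Type*} [Fintype α] (f : α → α) (w : α → ℕ) :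
    weight q t f w = q ^ (∑ x, itin f w x 0) *
      t ^ (Finset.univ.filter fun x => Drops (itin f w x)).card := by
  simp only [weight, wexc, itin_apply_zero]

/-- Standardization: the labelled sum counts each sorted structure `n!` times. -/
lemma factorial_mul_tsum_compat (n : ℕ) :
    (n.factorial : ℝ≥0∞) * ∑' p : {p : Perm (Fin n) × (Fin n → ℕ) // Compat p.1 p.2},
      q ^ (∑ i, p.1.2 i) * t ^ exc p.1.1 = total q t (Fin n) := by
  classical
  have h1 : total q t (Fin n) = ∑' y : Perm (Fin n) × (Fin n → ℕ), weight q t y.1 y.2 := by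
    rw [ENNReal.tsum_prod', tsum_fintype, total]
  have h2 : (n.factorial : ℝ≥0∞) *
      ∑' p : {p : Perm (Fin n) × (Fin n → ℕ) // Compat p.1 p.2},
        q ^ (∑ i, p.1.2 i) * t ^ exc p.1.1 =
      ∑' x : {p : Perm (Fin n) × (Fin n → ℕ) // Compat p.1 p.2} × Perm (Fin n),
        q ^ (∑ i, x.1.1.2 i) * t ^ exc x.1.1.1 := by
    rw [ENNReal.tsum_prod']
    simp only [tsum_fintype, Finset.sum_const, Finset.card_univ, Fintype.card_perm,
      Fintype.card_fin, nsmul_eq_mul]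
    rw [ENNReal.tsum_mul_left]
  -- The weight is a function of the itineraries, invariant under relabelling, so a bijection that
  -- respects the fibres suffices.
  let φ : (Fin n → ℕ → ℕ) → ℝ≥0∞ := fun T =>
    q ^ (∑ x, T x 0) * t ^ (Finset.univ.filter fun x => Drops (T x)).card
  have h3 : ∀ x : {p : Perm (Fin n) × (Fin n → ℕ) // Compat p.1 p.2} × Perm (Fin n),
      q ^ (∑ i, x.1.1.2 i) * t ^ exc x.1.1.1 = φ (itin x.1.1.1 x.1.1.2 ∘ x.2) := by
    rintro ⟨⟨⟨σ, c⟩, h⟩, g⟩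
    have h := h.wexc_eq
    simp only at h ⊢
    rw [← h, ← weight, weight_of_itin]
    simp only [φ, Function.comp_apply]
    congr 2
    · exact (Equiv.sum_comp g fun i => itin (⇑σ) c i 0).symm
    · rw [← Finset.card_map g.symm.toEmbedding]
      congr 1
      ext y
      simp [Finset.mem_map_equiv]
  rw [h1, h2]
  let e := (Equiv.sigmaFiberEquiv
      fun x : {p : Perm (Fin n) × (Fin n → ℕ) // Compat p.1 p.2} × Perm (Fin n) =>
        itin x.1.1.1 x.1.1.2 ∘ x.2).symm.trans
    ((Equiv.sigmaCongrRight fun T => (nonempty_fiber_equiv T).some).trans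
      (Equiv.sigmaFiberEquiv fun y : Perm (Fin n) × (Fin n → ℕ) => itin y.1 y.2))
  have he : ∀ x, itin (e x).1 (e x).2 = itin x.1.1.1 x.1.1.2 ∘ x.2 := fun x =>
    ((nonempty_fiber_equiv (itin x.1.1.1 x.1.1.2 ∘ x.2)).some ⟨x, rfl⟩).2
  rw [← e.tsum_eq]
  refine tsum_congr fun x => ?_
  rw [h3, weight_of_itin, he]

end

/-! ### Compatible sequences and the major index. -/

section

variable {n : ℕ}

lemma tsum_pi_prod (n : ℕ) (f : Fin n → ℕ → ℝ≥0∞) :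
    ∑' g : Fin n → ℕ, ∏ i, f i (g i) = ∏ i, ∑' k, f i k := by
  induction n with
  | zero => simp
  | succ n ih =>
    rw [← (Fin.consEquiv fun _ => ℕ).tsum_eq, ENNReal.tsum_prod', Fin.prod_univ_succ]
    simp only [Fin.prod_univ_succ, Fin.consEquiv_apply, Fin.cons_zero, Fin.cons_succ,
      ENNReal.tsum_mul_left, ih, ENNReal.tsum_mul_right]

open Classical in
/-- The indicator of a descent. -/
def desInd (σ : Perm (Fin n)) (i : Fin n) : ℕ := if i ∈ desSet σ then 1 else 0

/-- The value at the next position, or `0`. -/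
def nextVal (c : Fin n → ℕ) (i : Fin n) : ℕ :=
  if h : (i : ℕ) + 1 < n then c ⟨i + 1, h⟩ else 0

/-- The weakly decreasing sequence with gaps given by `g` plus the descent indicator. -/
def ofGaps (σ : Perm (Fin n)) (g : Fin n → ℕ) (i : Fin n) : ℕ :=
  ∑ j ∈ Finset.Ici i, (g j + desInd σ j)

lemma nextVal_ofGaps (σ : Perm (Fin n)) (g : Fin n → ℕ) (i : Fin n) :
    nextVal (ofGaps σ g) i = ∑ j ∈ Finset.Ioi i, (g j + desInd σ j) := by
  unfold nextVal ofGaps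
  split_ifs with h
  · congr 1
    ext j
    simp only [Finset.mem_Ici, Finset.mem_Ioi, Fin.le_def, Fin.lt_def]
    omega
  · symm
    refine Finset.sum_eq_zero fun j hj => ?_
    have := j.2
    rw [Finset.mem_Ioi, Fin.lt_def] at hj
    omega

lemma ofGaps_eq (σ : Perm (Fin n)) (g : Fin n → ℕ) (i : Fin n) :
    ofGaps σ g i = g i + desInd σ i + nextVal (ofGaps σ g) i := by
  rw [nextVal_ofGaps, ofGaps, ← Finset.Ioi_insert, Finset.sum_insert (by simp)]

lemma ofGaps_of_lt (σ : Perm (Fin n)) (g : Fin n → ℕ) {i j : Fin n} (h : i < j) :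
    ofGaps σ g i = ∑ k ∈ Finset.Ico i j, (g k + desInd σ k) + ofGaps σ g j := by
  rw [ofGaps, ofGaps, ← Finset.sum_union]
  · congr 1
    ext k
    simp only [Finset.mem_union, Finset.mem_Ici, Finset.mem_Ico, Fin.le_def, Fin.lt_def] at h ⊢
    omega
  · rw [Finset.disjoint_left]
    intro k
    simp only [Finset.mem_Ici, Finset.mem_Ico]
    intro h1 h2
    exact absurd h1.2 (not_lt_of_ge h2)

lemma lt_of_desInd_eq_zero {σ : Perm (Fin n)} {i j : Fin n} (hij : i < j)
    (h : ∀ k, i ≤ k → k < j → desInd σ k = 0) : σ i < σ j := by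
  have key : ∀ m : ℕ, ∀ hm : (i : ℕ) + 1 + m < n, (i : ℕ) + 1 + m ≤ j →
      σ i < σ ⟨i + 1 + m, hm⟩ := by
    have step : ∀ k l : Fin n, (l : ℕ) = k + 1 → i ≤ k → k < j → σ k < σ l := by
      intro k l hkl hik hkj
      have := h k hik hkj
      simp only [desInd, desSet, Finset.mem_filter_univ, ite_eq_right_iff, one_ne_zero,
        imp_false, not_exists, not_and, not_lt] at this
      refine lt_of_le_of_ne (this l hkl) fun he => ?_
      have := σ.injective he
      rw [this] at hkl
      omega
    intro m
    induction m with
    | zero => exact fun hm hj => step _ _ rfl le_rfl hij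
    | succ m ih =>
      intro hm hj
      refine (ih (by omega) (by omega)).trans (step _ _ rfl ?_ ?_)
      · simp only [Fin.le_def]; omega
      · simp only [Fin.lt_def]; omega
  rw [Fin.lt_def] at hij
  have := key (j - i - 1) (by omega) (by omega)
  convert this using 2
  ext
  simp only
  omega

/-- Equal values at $i<j$ force every gap and every descent indicator between them to vanish, so
$\sigma$ rises from $i$ to $j$. -/
lemma compat_ofGaps (σ : Perm (Fin n)) (g : Fin n → ℕ) : Compat σ (ofGaps σ g) := by
  refine ⟨fun i j hij => Finset.sum_le_sum_of_subset (Finset.Ici_subset_Ici.2 hij), ?_⟩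
  intro i j hij he
  rw [ofGaps_of_lt σ g hij] at he
  have h0 : ∑ k ∈ Finset.Ico i j, (g k + desInd σ k) = 0 := by omega
  refine lt_of_desInd_eq_zero hij fun k h1 h2 => ?_
  have := Finset.sum_eq_zero_iff.1 h0 k (Finset.mem_Ico.2 ⟨h1, h2⟩)
  omega

lemma Compat.nextVal_add_le {σ : Perm (Fin n)} {c : Fin n → ℕ} (h : Compat σ c) (i : Fin n) :
    nextVal c i + desInd σ i ≤ c i := by
  unfold nextVal desInd
  split_ifs with h1 h2 h2
  · rw [desSet, Finset.mem_filter_univ] at h2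
    obtain ⟨j, hj, hlt⟩ := h2
    have hj' : j = ⟨i + 1, h1⟩ := Fin.ext hj
    rw [← hj']
    have hij : i < j := by rw [Fin.lt_def]; omega
    rcases (h.1 hij.le).lt_or_eq with h3 | h3
    · omega
    · exact absurd (h.2 i j hij h3.symm) (not_lt_of_gt hlt)
  · exact h.1 (by rw [Fin.le_def]; simp)
  · rw [desSet, Finset.mem_filter_univ] at h2
    obtain ⟨j, hj, hlt⟩ := h2
    have := j.2
    omega
  · omega

/-- Compatible sequences are parametrized by their gaps. -/
def gapEquiv (σ : Perm (Fin n)) : (Fin n → ℕ) ≃ {c : Fin n → ℕ // Compat σ c} where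
  toFun g := ⟨ofGaps σ g, compat_ofGaps σ g⟩
  invFun c i := c.1 i - nextVal c.1 i - desInd σ i
  left_inv g := by
    funext i
    simp only
    rw [ofGaps_eq]
    omega
  right_inv := by
    rintro ⟨c, hc⟩
    simp only [Subtype.mk.injEq]
    set g : Fin n → ℕ := fun i => c i - nextVal c i - desInd σ i
    have key : ∀ m, ∀ i : Fin n, n - i = m → ofGaps σ g i = c i := by
      intro m
      induction m using Nat.strong_induction_on with
      | _ m ih =>
        intro i hi
        have h1 : nextVal (ofGaps σ g) i = nextVal c i := by
          unfold nextVal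
          split_ifs with h
          · exact ih (n - (i + 1)) (by omega) _ rfl
          · rfl
        have := hc.nextVal_add_le i
        rw [ofGaps_eq, h1]
        simp only [g]
        omega
    funext i
    exact key _ i rfl

/-- The increment at `j` is counted in the entries at `0, …, j`, that is `j + 1` times; the forced
units add up to the major index. -/
lemma sum_ofGaps (σ : Perm (Fin n)) (g : Fin n → ℕ) :
    ∑ i, ofGaps σ g i = ∑ j : Fin n, ((j : ℕ) + 1) * g j + maj σ := by
  have h1 : maj σ = ∑ j : Fin n, ((j : ℕ) + 1) * desInd σ j := by
    classical
    simp [maj, desInd, Finset.sum_ite_mem]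
  have h2 : ∑ i, ofGaps σ g i = ∑ j, ∑ i ∈ Finset.Iic j, (g j + desInd σ j) :=
    Finset.sum_comm' (by simp)
  rw [h1, h2, ← Finset.sum_add_distrib]
  refine Finset.sum_congr rfl fun j _ => ?_
  rw [Finset.sum_const, Fin.card_Iic, smul_eq_mul, mul_add]

lemma tsum_compat (q : ℝ≥0∞) (σ : Perm (Fin n)) :
    ∑' c : {c : Fin n → ℕ // Compat σ c}, q ^ (∑ i, c.1 i) =
      q ^ maj σ * ∏ i : Fin n, (1 - q ^ ((i : ℕ) + 1))⁻¹ := by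
  rw [← (gapEquiv σ).tsum_eq]
  have : ∀ g : Fin n → ℕ, q ^ (∑ i, (gapEquiv σ g).1 i) =
      q ^ maj σ * ∏ i : Fin n, (q ^ ((i : ℕ) + 1)) ^ g i := fun g => by
    change q ^ (∑ i, ofGaps σ g i) = _
    rw [sum_ofGaps, pow_add, mul_comm, ← Finset.prod_pow_eq_pow_sum]
    simp only [pow_mul]
  simp only [this, ENNReal.tsum_mul_left]
  rw [tsum_pi_prod n fun i k => (q ^ ((i : ℕ) + 1)) ^ k]
  simp only [ENNReal.tsum_geometric]

/-- The labelled sum in terms of the joint distribution of `maj` and `exc`. -/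
lemma total_eq (q t : ℝ≥0∞) (n : ℕ) :
    total q t (Fin n) = (n.factorial : ℝ≥0∞) *
      (jointPoly n q t * ∏ i : Fin n, (1 - q ^ ((i : ℕ) + 1))⁻¹) := by
  rw [← factorial_mul_tsum_compat]
  congr 1
  let e : (Σ σ : Perm (Fin n), {c : Fin n → ℕ // Compat σ c}) ≃
      {p : Perm (Fin n) × (Fin n → ℕ) // Compat p.1 p.2} :=
    { toFun := fun x => ⟨(x.1, x.2.1), x.2.2⟩
      invFun := fun p => ⟨p.1.1, p.1.2, p.2⟩
      left_inv := fun _ => rfl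
      right_inv := fun _ => rfl }
  rw [← e.tsum_eq, ENNReal.tsum_sigma', tsum_fintype, jointPoly, Finset.sum_mul]
  refine Finset.sum_congr rfl fun σ _ => ?_
  simp only [e, Equiv.coe_fn_mk]
  rw [ENNReal.tsum_mul_right, tsum_compat]
  ring

end

/-! ### Drops in finite words. -/

section Words

/-- The first letter of the word that differs from `a` is smaller than `a`, or there is none. -/
def nextSmaller (a : ℕ) : List ℕ → Bool
  | [] => true
  | b :: v => decide (b < a) || (b == a && nextSmaller a v)

/-- The number of letters of a word for which the next different letter is smaller or missing. -/
def dropCount : List ℕ → ℕ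
  | [] => 0
  | a :: v => (nextSmaller a v).toNat + dropCount v

/-- The word is cut just before a letter 0 of `s`, which lies below `a`. This is why a missing
letter counts as smaller. -/
lemma nextSmaller_map_range {a m : ℕ} (ha : a ≠ 0) {s : ℕ → ℕ} (hs : s m = 0) :
    nextSmaller a ((List.range m).map s) = true ↔ ∃ j, s j < a ∧ ∀ i < j, s i = a := by
  induction m generalizing s with
  | zero => simpa [nextSmaller] using ⟨0, by omega, by simp⟩
  | succ m ih =>
    have ih := ih (s := fun j => s (j + 1)) hs
    rw [List.range_succ_eq_map, List.map_cons, List.map_map]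
    simp only [nextSmaller, Bool.or_eq_true, decide_eq_true_eq, Bool.and_eq_true, beq_iff_eq]
    rw [show s ∘ Nat.succ = fun j => s (j + 1) from rfl, ih]
    constructor
    · rintro (h | ⟨h, j, hj, hlt⟩)
      · exact ⟨0, h, by simp⟩
      · refine ⟨j + 1, hj, ?_⟩
        rintro (_ | i) hi
        · exact h
        · exact hlt i (by omega)
    · rintro ⟨_ | j, hj, hlt⟩
      · exact Or.inl hj
      · exact Or.inr ⟨hlt 0 (by omega), j, hj, fun i hi => hlt (i + 1) (by omega)⟩

lemma drops_iff_tail {s : ℕ → ℕ} :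
    Drops s ↔ ∃ j, s (j + 1) < s 0 ∧ ∀ i < j, s (i + 1) = s 0 := by
  constructor
  · rintro ⟨_ | j, hj, hlt⟩
    · exact absurd hj (lt_irrefl _)
    · exact ⟨j, hj, fun i hi => hlt (i + 1) (by omega)⟩
  · rintro ⟨j, hj, hlt⟩
    refine ⟨j + 1, hj, ?_⟩
    rintro (_ | i) hi
    · rfl
    · exact hlt i (by omega)

open Classical in
lemma dropCount_map_range {m : ℕ} {s : ℕ → ℕ} (hs : s m = 0) (h0 : ∀ i < m, s i ≠ 0) :
    dropCount ((List.range m).map s) =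
      ∑ i ∈ Finset.range m, if Drops (fun j => s (i + j)) then 1 else 0 := by
  induction m generalizing s with
  | zero => rfl
  | succ m ih =>
    have ih := ih (s := fun j => s (j + 1)) hs fun i hi => h0 (i + 1) (by omega)
    rw [List.range_succ_eq_map, List.map_cons, List.map_map, dropCount,
      show s ∘ Nat.succ = fun j => s (j + 1) from rfl, ih, Finset.sum_range_succ', add_comm]
    congr 1
    · refine Finset.sum_congr rfl fun i _ => ?_
      congr 2
      funext j
      congr 1
      omega
    · have h1 : (fun j => s (0 + j)) = s := by funext j; rw [zero_add]
      have h2 : nextSmaller (s 0) ((List.range m).map fun j => s (j + 1)) = true ↔ Drops s := by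
        rw [nextSmaller_map_range (s := fun j => s (j + 1)) (h0 0 (by omega)) hs, drops_iff_tail]
      rw [h1]
      by_cases h : Drops s
      · rw [if_pos h, h2.2 h]; rfl
      · rw [if_neg h, Bool.eq_false_iff.2 fun h' => h (h2.1 h')]; rfl

lemma not_drops_of_zero {s : ℕ → ℕ} (h : s 0 = 0) : ¬ Drops s := by
  rintro ⟨j, hj, -⟩
  omega

lemma nextSmaller_map_succ (a : ℕ) (v : List ℕ) :
    nextSmaller (a + 1) (v.map Nat.succ) = nextSmaller a v := by
  induction v with
  | nil => rfl
  | cons b v ih => simp [nextSmaller, ih]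

lemma dropCount_map_succ (v : List ℕ) : dropCount (v.map Nat.succ) = dropCount v := by
  induction v with
  | nil => rfl
  | cons a v ih =>
    rw [List.map_cons, dropCount, dropCount, ih, Nat.succ_eq_add_one, nextSmaller_map_succ]

end Words

/-! ### First return to a letter 0, and rooting at a cycle. -/

section Return

variable {α : Type*}

lemma iterate_mul_of_fix {w : α → ℕ} {ρ : Perm α} (hρ : ∀ y, w y ≠ 0 → ρ y = y) (τ : Perm α)
    (x : α) {j : ℕ} (h : ∀ i < j, w (τ^[i + 1] x) ≠ 0) : (ρ * τ)^[j] x = τ^[j] x := by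
  induction j with
  | zero => rfl
  | succ j ih =>
    rw [Function.iterate_succ_apply', ih fun i hi => h i (by omega), Function.iterate_succ_apply',
      Perm.mul_apply]
    have := h j (by omega)
    rw [Function.iterate_succ_apply'] at this
    exact hρ _ this

lemma iterate_succ_mul_of_fix {w : α → ℕ} {ρ : Perm α} (hρ : ∀ y, w y ≠ 0 → ρ y = y)
    (τ : Perm α) (x : α) {j : ℕ} (h : ∀ i < j, w (τ^[i + 1] x) ≠ 0) :
    (ρ * τ)^[j + 1] x = ρ (τ^[j + 1] x) := by
  rw [Function.iterate_succ_apply', iterate_mul_of_fix hρ τ x h, Function.iterate_succ_apply',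
    Perm.mul_apply]

lemma letter_apply_of_fix {w : α → ℕ} {ρ : Perm α} (hρ : ∀ y, w y ≠ 0 → ρ y = y) (y : α) :
    w (ρ y) = w y := by
  by_cases h : w y = 0
  · by_contra hne
    have h1 := ρ.injective (hρ (ρ y) (by omega))
    rw [h1] at hne
    exact hne rfl
  · rw [hρ y h]

/-- Before the drop the orbit meets only the nonzero letter of `x`, where `ρ` acts trivially. At the
drop `ρ` can at most replace one point with letter 0 by another. -/
lemma drops_mul_of_fix {w : α → ℕ} {ρ : Perm α} (hρ : ∀ y, w y ≠ 0 → ρ y = y) {τ : Perm α}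
    {x : α} (h : Drops (itin τ w x)) : Drops (itin (ρ * τ) w x) := by
  by_cases hx : w x = 0
  · exact absurd h (not_drops_of_zero hx)
  obtain ⟨j, hj, hlt⟩ := h
  obtain _ | m := j
  · exact absurd hj (lt_irrefl _)
  have hne : ∀ i < m, w (τ^[i + 1] x) ≠ 0 := fun i hi => by
    have := hlt (i + 1) (by omega)
    simp only [itin, Function.iterate_zero, id] at this
    rwa [this]
  refine ⟨m + 1, ?_, fun i hi => ?_⟩
  · simp only [itin] at hj ⊢
    rw [iterate_succ_mul_of_fix hρ τ x hne, letter_apply_of_fix hρ]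
    exact hj
  · have := hlt i hi
    simp only [itin] at this ⊢
    rw [iterate_mul_of_fix hρ τ x fun k hk => hne k (by omega)]
    exact this

/-- The word spelled by the cycle of `p`, starting at `p`. -/
def cycleWord (τ : α → α) (w : α → ℕ) (p : α) : List ℕ :=
  (List.range (Function.minimalPeriod τ p)).map (itin τ w p)

lemma cycleWord_eq_cons {τ : Perm α} {p : α} {m : ℕ} (h : Function.minimalPeriod τ p = m + 1)
    (w : α → ℕ) :
    cycleWord τ w p = w p :: (List.range m).map fun i => w (τ^[i + 1] p) := by
  rw [cycleWord, h, List.range_succ_eq_map, List.map_cons, List.map_map]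
  rfl

lemma swap_fix [DecidableEq α] {w : α → ℕ} {p z : α} (hp : w p = 0) (hz : w z = 0)
    (y : α) (hy : w y ≠ 0) : swap p z y = y :=
  swap_apply_of_ne_of_ne (fun h => hy (h ▸ hp)) (fun h => hy (h ▸ hz))

section

variable [Fintype α]

lemma iterate_pos_period (τ : Perm α) (p : α) : ∃ m, τ^[m + 1] p = p := by
  obtain ⟨m, hm⟩ := Nat.exists_eq_succ_of_ne_zero (orderOf_pos τ).ne'
  exact ⟨m, by rw [← Nat.succ_eq_add_one, ← hm, ← Perm.coe_pow, pow_orderOf_eq_one]; rfl⟩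

/-- The first point after `p` on its cycle, `p` included, with the letter `0`. -/
def ret (w : α → ℕ) {p : α} (hp : w p = 0) (τ : Perm α) : α :=
  τ^[Nat.find (p := fun m => w (τ^[m + 1] p) = 0)
    ((iterate_pos_period τ p).imp fun m hm => by rw [hm, hp]) + 1] p

lemma ret_eq_iff {w : α → ℕ} {p : α} (hp : w p = 0) {τ : Perm α} {z : α} :
    ret w hp τ = z ↔ ∃ m, τ^[m + 1] p = z ∧ w z = 0 ∧ ∀ i < m, w (τ^[i + 1] p) ≠ 0 := by
  have hex : ∃ m, w (τ^[m + 1] p) = 0 := (iterate_pos_period τ p).imp fun m hm => by rw [hm, hp]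
  constructor
  · rintro rfl
    exact ⟨Nat.find hex, rfl, Nat.find_spec hex, fun i hi => Nat.find_min hex hi⟩
  · rintro ⟨m, rfl, hz, hlt⟩
    rw [ret, (Nat.find_eq_iff hex).2 ⟨hz, hlt⟩]

lemma wexc_mul_of_fix {w : α → ℕ} {ρ : Perm α} (hρ : ∀ y, w y ≠ 0 → ρ y = y) (τ : Perm α) :
    wexc (ρ * τ) w = wexc τ w := by
  have hρ' : ∀ y, w y ≠ 0 → ρ⁻¹ y = y := fun y hy =>
    ρ.injective ((apply_inv_apply ρ y).trans (hρ y hy).symm)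
  unfold wexc
  congr 1
  ext x
  simp only [Finset.mem_filter_univ]
  refine ⟨fun h => ?_, drops_mul_of_fix hρ⟩
  have := drops_mul_of_fix (τ := ρ * τ) hρ' h
  simpa [inv_mul_cancel_left] using this

lemma ret_letter {w : α → ℕ} {p : α} (hp : w p = 0) (τ : Perm α) : w (ret w hp τ) = 0 := by
  obtain ⟨m, hm, h0, hlt⟩ := (ret_eq_iff hp (τ := τ)).1 rfl
  exact h0

open Classical in
/-- The number of points off the cycle of `p` whose itinerary drops. -/
def wexcOff (τ : Perm α) (w : α → ℕ) (p : α) : ℕ :=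
  (Finset.univ.filter fun x => ¬ τ.SameCycle p x ∧ Drops (itin τ w x)).card

lemma sameCycle_iff_iterate {τ : Perm α} {p x : α} : τ.SameCycle p x ↔ ∃ i, τ^[i] p = x := by
  constructor
  · intro h
    obtain ⟨i, hi⟩ := h.exists_nat_pow_eq
    exact ⟨i, by rw [← Perm.coe_pow]; exact hi⟩
  · rintro ⟨i, rfl⟩
    exact ⟨i, by rw [zpow_natCast, Perm.coe_pow]⟩

lemma minimalPeriod_pos (τ : Perm α) (p : α) : 0 < Function.minimalPeriod τ p :=
  Function.minimalPeriod_pos_iff_mem_periodicPts.2 (τ.injective.mem_periodicPts p)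

open Classical in
lemma wexc_eq_off_add (τ : Perm α) (w : α → ℕ) (p : α) :
    wexc τ w = wexcOff τ w p + ∑ i ∈ Finset.range (Function.minimalPeriod τ p),
      if Drops (itin τ w (τ^[i] p)) then 1 else 0 := by
  rw [← Finset.card_filter, wexc, wexcOff,
    ← Finset.card_filter_add_card_filter_not (fun x => ¬ τ.SameCycle p x), Finset.filter_filter,
    Finset.filter_filter]
  congr 1
  · congr 1
    ext x
    simp only [Finset.mem_filter_univ]
    tauto
  · symm
    refine Finset.card_bij (fun i _ => τ^[i] p) ?_ ?_ ?_
    · intro i hi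
      simp only [Finset.mem_filter, not_not, Finset.mem_univ, true_and] at hi ⊢
      exact ⟨hi.2, sameCycle_iff_iterate.2 ⟨i, rfl⟩⟩
    · intro i hi j hj h
      simp only [Finset.mem_filter, Finset.mem_range] at hi hj
      exact Function.iterate_injOn_Iio_minimalPeriod hi.1 hj.1 h
    · intro x hx
      simp only [Finset.mem_filter_univ, not_not] at hx
      obtain ⟨i, rfl⟩ := sameCycle_iff_iterate.1 hx.2
      refine ⟨i % Function.minimalPeriod τ p, ?_, Function.iterate_mod_minimalPeriod_eq⟩
      rw [Finset.mem_filter, Finset.mem_range, Function.iterate_mod_minimalPeriod_eq]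
      exact ⟨Nat.mod_lt _ (minimalPeriod_pos τ p), hx.1⟩

/-- The weight of a cycle word whose only letter `0` is the first one. -/
def rootWeight (t : ℝ≥0∞) : List ℕ → ℝ≥0∞
  | [] => 0
  | a :: v => if a = 0 ∧ 0 ∉ v then t ^ dropCount v else 0

lemma rootWeight_cycleWord_of_ne (t : ℝ≥0∞) {w : α → ℕ} {p : α} (hp : w p ≠ 0) (τ : Perm α) :
    rootWeight t (cycleWord τ w p) = 0 := by
  obtain ⟨m, hm⟩ := Nat.exists_eq_succ_of_ne_zero (minimalPeriod_pos τ p).ne'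
  rw [cycleWord_eq_cons hm, rootWeight, if_neg fun h => hp h.1]

lemma wexc_succ (f : α → α) (w : α → ℕ) : wexc f (fun x => w x + 1) = wexc f w := by
  unfold wexc
  congr 1
  ext x
  have : Drops (itin f (fun x => w x + 1) x) ↔ Drops (itin f w x) := by simp [Drops, itin]
  simp only [Finset.mem_filter_univ, this]

end

variable [Fintype α] [DecidableEq α]

/-- The path from `p` to its first return passes only through nonzero letters, so the swap affects
its endpoint alone. -/
lemma ret_swap_mul {w : α → ℕ} {p z : α} (hp : w p = 0) (hz : w z = 0) (τ : Perm α) :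
    ret w hp (swap p z * τ) = swap p z (ret w hp τ) := by
  obtain ⟨m, hm, h0, hlt⟩ := (ret_eq_iff hp (τ := τ)).1 rfl
  rw [ret_eq_iff]
  refine ⟨m, ?_, ?_, fun i hi => ?_⟩
  · rw [iterate_succ_mul_of_fix (swap_fix hp hz) τ p hlt, hm]
  · rw [letter_apply_of_fix (swap_fix hp hz), h0]
  · rw [iterate_mul_of_fix (swap_fix hp hz) τ p fun k hk => hlt k (by omega)]
    exact hlt i hi

/-- Left multiplication by `swap p z` exchanges the permutations returning to `z` with those
returning to `p` and preserves drops, so the return point is equidistributed over the zeros. -/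
lemma sum_pow_wexc (t : ℝ≥0∞) {w : α → ℕ} {p : α} (hp : w p = 0) :
    ∑ τ : Perm α, t ^ wexc τ w = (Finset.univ.filter fun z => w z = 0).card *
      ∑ τ : Perm α, if ret w hp τ = p then t ^ wexc τ w else 0 := by
  rw [← Finset.sum_fiberwise_of_maps_to (t := Finset.univ.filter fun z => w z = 0)
    (g := ret w hp) (fun τ _ => by simpa using ret_letter hp τ), ← nsmul_eq_mul]
  refine Finset.sum_eq_card_nsmul fun z hz => ?_
  have hz : w z = 0 := by simpa using hz
  rw [Finset.sum_filter, ← Equiv.sum_comp (Equiv.mulLeft (swap p z))]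
  refine Finset.sum_congr rfl fun τ _ => ?_
  rw [Equiv.coe_mulLeft, ret_swap_mul hp hz, wexc_mul_of_fix (swap_fix hp hz)]
  congr 1
  rw [Equiv.swap_apply_eq_iff, Equiv.swap_apply_right]

lemma sum_pow_wexc_eq_sum_ret (t : ℝ≥0∞) {w : α → ℕ} (hw : ∃ p, w p = 0) :
    ∑ τ : Perm α, t ^ wexc τ w =
      ∑ p, ∑ τ : Perm α, if h : w p = 0 then if ret w h τ = p then t ^ wexc τ w else 0 else 0 := by
  set Z := Finset.univ.filter fun z => w z = 0
  have hZ : (Z.card : ℝ≥0∞) ≠ 0 := by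
    obtain ⟨p, hp⟩ := hw
    simpa using Finset.ne_empty_of_mem (show p ∈ Z by simp [Z, hp])
  -- After multiplication by the number of zeros, each zero `p` contributes one copy of the left
  -- side.
  rw [← ENNReal.mul_right_inj hZ (ENNReal.natCast_ne_top _), ← nsmul_eq_mul,
    ← Finset.sum_const, Finset.mul_sum, Finset.sum_filter]
  refine Finset.sum_congr rfl fun p _ => ?_
  split_ifs with hp
  · exact sum_pow_wexc t hp
  · simp

/-- The first return to 0 is `p` itself exactly when `p` carries the only 0 of its cycle. The
remaining letters then form a word followed by that 0, which matches the end convention of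
`dropCount`; `p` itself never drops. -/
lemma ret_pow_wexc (t : ℝ≥0∞) {w : α → ℕ} {p : α} (hp : w p = 0) (τ : Perm α) :
    (if ret w hp τ = p then t ^ wexc τ w else 0) =
      rootWeight t (cycleWord τ w p) * t ^ wexcOff τ w p := by
  classical
  obtain ⟨m, hm⟩ := Nat.exists_eq_succ_of_ne_zero (minimalPeriod_pos τ p).ne'
  have hper : τ^[m + 1] p = p := by
    rw [← Nat.succ_eq_add_one, ← hm]
    exact Function.iterate_minimalPeriod
  have hiff : ret w hp τ = p ↔ ∀ i < m, w (τ^[i + 1] p) ≠ 0 := by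
    rw [ret_eq_iff]
    constructor
    · rintro ⟨k, hk, -, hlt⟩
      have : m ≤ k := by
        have := Function.IsPeriodicPt.minimalPeriod_le (by omega) hk
        omega
      exact fun i hi => hlt i (by omega)
    · exact fun h => ⟨m, hper, hp, h⟩
  have hmem : (0 ∉ (List.range m).map fun i => w (τ^[i + 1] p)) ↔
      ∀ i < m, w (τ^[i + 1] p) ≠ 0 := by simp
  rw [cycleWord_eq_cons hm, rootWeight]
  by_cases h : ∀ i < m, w (τ^[i + 1] p) ≠ 0
  · rw [if_pos (hiff.2 h), if_pos ⟨hp, hmem.2 h⟩, ← pow_add, wexc_eq_off_add τ w p, hm,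
      Finset.sum_range_succ', if_neg (not_drops_of_zero hp), add_zero, add_comm,
      dropCount_map_range (s := fun i => w (τ^[i + 1] p)) (by rw [hper, hp]) h]
    congr 2
    refine Finset.sum_congr rfl fun i _ => ?_
    congr 2
    funext j
    simp only [itin]
    rw [← Function.iterate_add_apply]
    congr 2
    omega
  · rw [if_neg fun h' => h (hiff.1 h'), if_neg fun h' => h (hmem.1 h'.2), zero_mul]

/-- The weighted sum over permutations with letters, where the cycle of `p` is weighted by a
function of its word. -/
def rootedTotal (q t : ℝ≥0∞) (α : Type*) [Fintype α] [DecidableEq α] (p : α)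
    (Ψ : List ℕ → ℝ≥0∞) : ℝ≥0∞ :=
  ∑ τ : Perm α, ∑' w : α → ℕ, q ^ (∑ x, w x) * (Ψ (cycleWord τ w p) * t ^ wexcOff τ w p)

/-- The first term collects the letterings without 0: lowering every letter by 1 keeps the drops and
takes out one factor `q` per point. The others are rooted by `sum_pow_wexc_eq_sum_ret`. -/
lemma total_eq_add_sum_rooted (q t : ℝ≥0∞) :
    total q t α = q ^ Fintype.card α * total q t α +
      ∑ p, rootedTotal q t α p (rootWeight t) := by
  have h1 : q ^ Fintype.card α * total q t α =
      ∑ τ : Perm α, ∑' w : α → ℕ, if ∃ p, w p = 0 then 0 else weight q t τ w := by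
    rw [total, Finset.mul_sum]
    refine Finset.sum_congr rfl fun τ _ => ?_
    have hinj : Function.Injective fun (w : α → ℕ) (x : α) => w x + 1 := fun w w' h => by
      funext x
      simpa using congrFun h x
    rw [← ENNReal.tsum_mul_left,
      ← hinj.tsum_eq (f := fun w => if ∃ p, w p = 0 then 0 else weight q t τ w)]
    · refine tsum_congr fun w => ?_
      rw [if_neg (by simp), weight, weight, wexc_succ, Finset.sum_add_distrib, pow_add,
        Finset.sum_const, Finset.card_univ, smul_eq_mul, mul_one]
      ring
    · intro w hw
      have hw : ¬ ∃ p, w p = 0 := fun h => hw (if_pos h)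
      push Not at hw
      exact ⟨fun x => w x - 1, funext fun x => Nat.sub_add_cancel (Nat.pos_of_ne_zero (hw x))⟩
  have h2 : ∀ w : α → ℕ, ∑ τ : Perm α, (if ∃ p, w p = 0 then weight q t τ w else 0) =
      ∑ p, ∑ τ : Perm α, q ^ (∑ x, w x) *
        (rootWeight t (cycleWord τ w p) * t ^ wexcOff τ w p) := by
    intro w
    split_ifs with hw
    · simp only [weight, ← Finset.mul_sum]
      rw [sum_pow_wexc_eq_sum_ret t hw]
      congr 1
      refine Finset.sum_congr rfl fun p _ => Finset.sum_congr rfl fun τ _ => ?_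
      split_ifs with hp
      · rw [← ret_pow_wexc t hp, if_pos ‹_›]
      · rw [← ret_pow_wexc t hp, if_neg ‹_›]
      · rw [rootWeight_cycleWord_of_ne t hp, zero_mul]
    · push Not at hw
      simp [rootWeight_cycleWord_of_ne t (hw _)]
  have h3 : ∑ p, rootedTotal q t α p (rootWeight t) =
      ∑ τ : Perm α, ∑' w : α → ℕ, if ∃ p, w p = 0 then weight q t τ w else 0 := by
    rw [← Summable.tsum_finsetSum fun _ _ => ENNReal.summable]
    simp only [h2, rootedTotal]
    rw [Summable.tsum_finsetSum fun _ _ => ENNReal.summable]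
    refine Finset.sum_congr rfl fun p _ => ?_
    rw [Summable.tsum_finsetSum fun _ _ => ENNReal.summable]
  rw [h1, h3, ← Finset.sum_add_distrib, total]
  refine Finset.sum_congr rfl fun τ _ => ?_
  rw [← ENNReal.tsum_add]
  refine tsum_congr fun w => ?_
  split_ifs <;> simp

end Return

/-! ### Invariance under relabelling. -/

section Relabel

variable {α β : Type*}

lemma minimalPeriod_conj (e : α ≃ β) (f : α → α) (p : α) :
    Function.minimalPeriod (e ∘ f ∘ e.symm) (e p) = Function.minimalPeriod f p := by
  have hsc : Function.Semiconj e f (e ∘ f ∘ e.symm) := fun x => by simp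
  rw [Function.minimalPeriod_eq_minimalPeriod_iff]
  intro n
  unfold Function.IsPeriodicPt Function.IsFixedPt
  rw [← hsc.iterate_right n p, e.injective.eq_iff]

lemma cycleWord_conj (e : α ≃ β) (f : α → α) (w : β → ℕ) (p : α) :
    cycleWord (e ∘ f ∘ e.symm) w (e p) = cycleWord f (w ∘ e) p := by
  rw [cycleWord, cycleWord, minimalPeriod_conj, itin_conj, e.symm_apply_apply]

variable [Fintype α] [Fintype β]

lemma sameCycle_permCongr (e : α ≃ β) (τ : Perm α) (p x : α) :
    (e.permCongr τ).SameCycle (e p) (e x) ↔ τ.SameCycle p x := by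
  rw [sameCycle_iff_iterate, sameCycle_iff_iterate]
  have hsc : Function.Semiconj e τ (e.permCongr τ) := fun x => by simp
  refine exists_congr fun i => ?_
  rw [← hsc.iterate_right i p, e.injective.eq_iff]

lemma wexcOff_permCongr (e : α ≃ β) (τ : Perm α) (w : β → ℕ) (p : α) :
    wexcOff (e.permCongr τ) w (e p) = wexcOff τ (w ∘ e) p := by
  classical
  unfold wexcOff
  rw [← Finset.card_map e.toEmbedding]
  congr 1
  ext y
  obtain ⟨x, rfl⟩ := e.surjective y
  have h1 : itin (e.permCongr τ) w (e x) = itin τ (w ∘ e) x :=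
    (itin_conj e τ w (e x)).trans (by rw [e.symm_apply_apply])
  simp only [Finset.mem_filter_univ, Finset.mem_map_equiv, e.symm_apply_apply,
    sameCycle_permCongr, h1]

variable [DecidableEq α] [DecidableEq β]

lemma rootedTotal_congr (q t : ℝ≥0∞) (e : α ≃ β) (p : α) (Ψ : List ℕ → ℝ≥0∞) :
    rootedTotal q t β (e p) Ψ = rootedTotal q t α p Ψ := by
  rw [rootedTotal, rootedTotal, ← Equiv.sum_comp e.permCongr]
  refine Finset.sum_congr rfl fun τ _ => ?_
  rw [← (e.symm.arrowCongr (Equiv.refl ℕ)).tsum_eq]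
  refine tsum_congr fun w => ?_
  have h1 : (e.symm.arrowCongr (Equiv.refl ℕ)) w = w ∘ e := rfl
  rw [h1, wexcOff_permCongr, ← cycleWord_conj, ← Equiv.sum_comp e w]
  rfl

end Relabel

/-! ### Removing the root from its cycle. -/

section Contract

variable {α : Type*}

/-- Letters on `α` together with a letter for the new point. -/
def consLetter (a : ℕ) (w : α → ℕ) (x : Option α) : ℕ := x.elim a w

lemma tsum_option (f : (Option α → ℕ) → ℝ≥0∞) :
    ∑' w, f w = ∑' a : ℕ, ∑' w : α → ℕ, f (consLetter a w) := by
  rw [← (piOptionEquivProd (β := fun _ : Option α => ℕ)).symm.tsum_eq, ENNReal.tsum_prod']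
  refine tsum_congr fun a => tsum_congr fun w => congrArg f ?_
  funext x
  cases x <;> rfl

section

variable [DecidableEq α]

/-- The permutation `τ` with the new point `none` inserted before `x`. -/
def insertBefore (x : Option α) (τ : Perm α) : Perm (Option α) :=
  Perm.decomposeOption.symm (x, τ)

lemma insertBefore_none (τ : Perm α) (x : Option α) : insertBefore none τ x = x.map τ :=
  Perm.decomposeOption_symm_of_none_apply τ x

lemma insertBefore_apply_none (y : α) (τ : Perm α) : insertBefore (some y) τ none = some y := by
  simp [insertBefore]

lemma insertBefore_apply_some_of_eq {y z : α} {τ : Perm α} (h : τ z = y) :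
    insertBefore (some y) τ (some z) = none := by
  simp [insertBefore, h]

lemma insertBefore_apply_some_of_ne {y z : α} {τ : Perm α} (h : τ z ≠ y) :
    insertBefore (some y) τ (some z) = some (τ z) := by
  simp only [insertBefore, Perm.decomposeOption_symm_apply, Perm.mul_apply, optionCongr_apply,
    Option.map_some]
  exact swap_apply_of_ne_of_ne (by simp) (by simpa using h)

lemma iterate_insertBefore_none_some (τ : Perm α) (x : α) (i : ℕ) :
    (insertBefore none τ)^[i] (some x) = some (τ^[i] x) := by
  induction i with
  | zero => rfl
  | succ i ih =>
    rw [Function.iterate_succ_apply', ih, insertBefore_none, Option.map_some,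
      Function.iterate_succ_apply']

lemma iterate_insertBefore_none_none (τ : Perm α) (i : ℕ) :
    (insertBefore none τ)^[i] none = none := by
  induction i with
  | zero => rfl
  | succ i ih => rw [Function.iterate_succ_apply', ih, insertBefore_none, Option.map_none]

lemma cycleWord_insertBefore_none (a : ℕ) (w : α → ℕ) (τ : Perm α) :
    cycleWord (insertBefore none τ) (consLetter a w) none = [a] := by
  have : Function.minimalPeriod (insertBefore none τ) none = 0 + 1 :=
    Function.minimalPeriod_eq_one_iff_isFixedPt.2 (insertBefore_none τ none)
  rw [cycleWord_eq_cons this]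
  rfl

lemma itin_insertBefore_none (a : ℕ) (w : α → ℕ) (τ : Perm α) (x : α) :
    itin (insertBefore none τ) (consLetter a w) (some x) = itin τ w x := by
  funext i
  rw [itin, iterate_insertBefore_none_some]
  rfl

lemma iterate_insertBefore_root {y : α} {τ : Perm α} {i : ℕ}
    (hi : i < Function.minimalPeriod τ y) :
    (insertBefore (some y) τ)^[i + 1] none = some (τ^[i] y) := by
  induction i with
  | zero => exact insertBefore_apply_none y τ
  | succ i ih =>
    rw [Function.iterate_succ_apply', ih (by omega), Function.iterate_succ_apply']
    refine insertBefore_apply_some_of_ne fun h => ?_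
    have h := (Function.iterate_succ_apply' τ i y).trans h
    have := Function.IsPeriodicPt.minimalPeriod_le (by omega) h
    omega

end

variable [Fintype α] [DecidableEq α]

lemma wexcOff_insertBefore_none (a : ℕ) (w : α → ℕ) (τ : Perm α) :
    wexcOff (insertBefore none τ) (consLetter a w) none = wexc τ w := by
  classical
  unfold wexcOff wexc
  rw [← Finset.card_map (Function.Embedding.some (α := α))]
  congr 1
  ext (_ | x)
  · simp [Perm.SameCycle.refl]
  · have : ¬ (insertBefore none τ).SameCycle none (some x) := by
      rw [sameCycle_iff_iterate]
      simp [iterate_insertBefore_none_none]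
    simp [this, itin_insertBefore_none]

lemma minimalPeriod_insertBefore (y : α) (τ : Perm α) :
    Function.minimalPeriod (insertBefore (some y) τ) none =
      Function.minimalPeriod τ y + 1 := by
  obtain ⟨k, hk⟩ := Nat.exists_eq_succ_of_ne_zero (minimalPeriod_pos τ y).ne'
  refine le_antisymm (Function.IsPeriodicPt.minimalPeriod_le (by omega) ?_) ?_
  · have h1 := Function.iterate_minimalPeriod (f := τ) (x := y)
    rw [hk, Nat.succ_eq_add_one, Function.iterate_succ_apply'] at h1
    rw [hk, Nat.succ_eq_add_one, Function.IsPeriodicPt, Function.IsFixedPt,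
      Function.iterate_succ_apply', iterate_insertBefore_root (by omega)]
    exact insertBefore_apply_some_of_eq h1
  · by_contra! hlt
    obtain ⟨m, hm⟩ := Nat.exists_eq_succ_of_ne_zero
      (minimalPeriod_pos (insertBefore (some y) τ) none).ne'
    have h1 := Function.iterate_minimalPeriod (f := insertBefore (some y) τ) (x := none)
    rw [hm, Nat.succ_eq_add_one, iterate_insertBefore_root (by omega)] at h1
    exact Option.some_ne_none _ h1

lemma cycleWord_insertBefore_some (a : ℕ) (w : α → ℕ) (y : α) (τ : Perm α) :
    cycleWord (insertBefore (some y) τ) (consLetter a w) none = a :: cycleWord τ w y := by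
  rw [cycleWord_eq_cons (minimalPeriod_insertBefore y τ), cycleWord]
  congr 1
  refine List.map_congr_left fun i hi => ?_
  rw [iterate_insertBefore_root (List.mem_range.1 hi)]
  rfl

lemma sameCycle_insertBefore (y z : α) (τ : Perm α) :
    (insertBefore (some y) τ).SameCycle none (some z) ↔ τ.SameCycle y z := by
  rw [sameCycle_iff_iterate, sameCycle_iff_iterate]
  constructor
  · rintro ⟨i, hi⟩
    rw [← Function.iterate_mod_minimalPeriod_eq, minimalPeriod_insertBefore] at hi
    have hlt := Nat.mod_lt i (Nat.succ_pos (Function.minimalPeriod τ y))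
    rw [Nat.succ_eq_add_one] at hlt
    generalize i % (Function.minimalPeriod τ y + 1) = j at hi hlt
    obtain _ | j := j
    · exact absurd hi.symm (Option.some_ne_none _)
    · rw [iterate_insertBefore_root (by omega)] at hi
      exact ⟨j, Option.some_injective _ hi⟩
  · rintro ⟨i, rfl⟩
    refine ⟨i % Function.minimalPeriod τ y + 1, ?_⟩
    rw [iterate_insertBefore_root (Nat.mod_lt _ (minimalPeriod_pos τ y)),
      Function.iterate_mod_minimalPeriod_eq]

lemma itin_insertBefore_some (a : ℕ) (w : α → ℕ) {y z : α} {τ : Perm α}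
    (h : ¬ τ.SameCycle y z) :
    itin (insertBefore (some y) τ) (consLetter a w) (some z) = itin τ w z := by
  have key : ∀ i, (insertBefore (some y) τ)^[i] (some z) = some (τ^[i] z) := by
    intro i
    induction i with
    | zero => rfl
    | succ i ih =>
      rw [Function.iterate_succ_apply', ih, Function.iterate_succ_apply']
      refine insertBefore_apply_some_of_ne fun h' => h ?_
      have h' := (Function.iterate_succ_apply' τ i z).trans h'
      exact (sameCycle_iff_iterate.2 ⟨_, h'⟩).symm
  funext i
  rw [itin, key]
  rfl

lemma wexcOff_insertBefore_some (a : ℕ) (w : α → ℕ) (y : α) (τ : Perm α) :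
    wexcOff (insertBefore (some y) τ) (consLetter a w) none = wexcOff τ w y := by
  classical
  unfold wexcOff
  rw [← Finset.card_map (Function.Embedding.some (α := α))]
  congr 1
  ext (_ | z)
  · simp [Perm.SameCycle.refl]
  · by_cases h : τ.SameCycle y z
    · simp [sameCycle_insertBefore, h]
    · simp [sameCycle_insertBefore, h, itin_insertBefore_some a w h]

/-- Either the root is a fixed point and the rest is unrestricted, or its successor `y` becomes the
new root and the cycle word loses its first letter. -/
lemma rootedTotal_option (q t : ℝ≥0∞) (Ψ : List ℕ → ℝ≥0∞) :
    rootedTotal q t (Option α) none Ψ = (∑' a, q ^ a * Ψ [a]) * total q t α +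
      ∑ y, ∑' a, q ^ a * rootedTotal q t α y fun v => Ψ (a :: v) := by
  have h1 : ∀ (τ : Perm (Option α)), ∑' w : Option α → ℕ,
      q ^ (∑ x, w x) * (Ψ (cycleWord τ w none) * t ^ wexcOff τ w none) =
      ∑' a, q ^ a * ∑' w : α → ℕ, q ^ (∑ x, w x) * (Ψ (cycleWord τ (consLetter a w) none) *
        t ^ wexcOff τ (consLetter a w) none) := fun τ => by
    rw [tsum_option]
    refine tsum_congr fun a => ?_
    rw [← ENNReal.tsum_mul_left]
    refine tsum_congr fun w => ?_
    rw [Fintype.sum_option, pow_add]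
    simp only [consLetter, Option.elim]
    ring
  rw [rootedTotal, ← Equiv.sum_comp Perm.decomposeOption.symm, Fintype.sum_prod_type,
    Fintype.sum_option]
  simp only [h1]
  congr 1
  · rw [total, Finset.mul_sum]
    refine Finset.sum_congr rfl fun τ _ => ?_
    rw [← ENNReal.tsum_mul_right]
    refine tsum_congr fun a => ?_
    rw [mul_assoc, ← ENNReal.tsum_mul_left (a := Ψ [a])]
    congr 1
    refine tsum_congr fun w => ?_
    change q ^ (∑ x, w x) * (Ψ (cycleWord (insertBefore none τ) (consLetter a w) none) *
        t ^ wexcOff (insertBefore none τ) (consLetter a w) none) = _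
    rw [cycleWord_insertBefore_none, wexcOff_insertBefore_none, weight]
    ring
  · refine Finset.sum_congr rfl fun y _ => ?_
    rw [← Summable.tsum_finsetSum fun _ _ => ENNReal.summable]
    refine tsum_congr fun a => ?_
    rw [← Finset.mul_sum, rootedTotal]
    congr 1
    refine Finset.sum_congr rfl fun τ _ => tsum_congr fun w => ?_
    change q ^ (∑ x, w x) * (Ψ (cycleWord (insertBefore (some y) τ) (consLetter a w) none) *
        t ^ wexcOff (insertBefore (some y) τ) (consLetter a w) none) = _
    rw [cycleWord_insertBefore_some, wexcOff_insertBefore_some]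

end Contract

/-! ### Word sums and the two recursions. -/

section WordSums

variable (q t : ℝ≥0∞)

/-- The sum of `q ^ (v₁ + ⋯ + v_k) * Ψ v` over the words `v` of length `k`. -/
def wordSum : ℕ → (List ℕ → ℝ≥0∞) → ℝ≥0∞
  | 0, Ψ => Ψ []
  | k + 1, Ψ => ∑' a, q ^ a * wordSum k fun v => Ψ (a :: v)

lemma wordSum_zero_fun (k : ℕ) : wordSum q k (fun _ => 0) = 0 := by
  induction k with
  | zero => rfl
  | succ k ih => simp [wordSum, ih]

lemma wordSum_add (k : ℕ) (Ψ Φ : List ℕ → ℝ≥0∞) :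
    wordSum q k (fun v => Ψ v + Φ v) = wordSum q k Ψ + wordSum q k Φ := by
  induction k generalizing Ψ Φ with
  | zero => rfl
  | succ k ih => simp only [wordSum, ih, mul_add, ENNReal.tsum_add]

lemma wordSum_mul_left (k : ℕ) (c : ℝ≥0∞) (Ψ : List ℕ → ℝ≥0∞) :
    wordSum q k (fun v => c * Ψ v) = c * wordSum q k Ψ := by
  induction k generalizing Ψ with
  | zero => rfl
  | succ k ih =>
    simp only [wordSum, ih]
    rw [← ENNReal.tsum_mul_left]
    exact tsum_congr fun a => by ring

lemma wordSum_mono {k : ℕ} {Ψ Φ : List ℕ → ℝ≥0∞} (h : ∀ v, Ψ v ≤ Φ v) :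
    wordSum q k Ψ ≤ wordSum q k Φ := by
  induction k generalizing Ψ Φ with
  | zero => exact h _
  | succ k ih => exact ENNReal.tsum_le_tsum fun a => mul_le_mul_right (ih fun v => h _) _

lemma wordSum_one (k : ℕ) : wordSum q k (fun _ => 1) = ((1 - q)⁻¹) ^ k := by
  induction k with
  | zero => rw [pow_zero, wordSum]
  | succ k ih => simp only [wordSum, ih, ENNReal.tsum_mul_right, ENNReal.tsum_geometric, pow_succ']

lemma tsum_nat_split (f : ℕ → ℝ≥0∞) : ∑' a, f a = f 0 + ∑' a, f (a + 1) :=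
  tsum_eq_zero_add' ENNReal.summable

open Classical in
lemma wordSum_not_mem_zero (k : ℕ) (Ψ : List ℕ → ℝ≥0∞) :
    wordSum q k (fun v => if 0 ∉ v then Ψ v else 0) =
      q ^ k * wordSum q k fun v => Ψ (v.map Nat.succ) := by
  induction k generalizing Ψ with
  | zero => simp [wordSum]
  | succ k ih =>
    rw [wordSum, tsum_nat_split, wordSum, ← ENNReal.tsum_mul_left]
    have h1 : wordSum q k (fun v => if 0 ∉ 0 :: v then Ψ (0 :: v) else 0) = 0 := by
      simp [wordSum_zero_fun]
    rw [h1, mul_zero, zero_add]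
    refine tsum_congr fun a => ?_
    have h2 : (fun v => if 0 ∉ (a + 1) :: v then Ψ ((a + 1) :: v) else 0) =
        fun v => if 0 ∉ v then Ψ ((a + 1) :: v) else 0 := by
      funext v; simp
    rw [h2, ih]
    simp only [List.map_cons, Nat.succ_eq_add_one]
    ring

/-- The generating function of the words of length `k` by the number of drops. -/
def dropSum (k : ℕ) : ℝ≥0∞ := wordSum q k fun v => t ^ dropCount v

lemma wordSum_rootWeight (k : ℕ) :
    wordSum q (k + 1) (rootWeight t) = q ^ k * dropSum q t k := by
  rw [wordSum, tsum_nat_split]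
  have h1 : ∀ a, wordSum q k (fun v => rootWeight t ((a + 1) :: v)) = 0 := fun a => by
    simp [rootWeight, wordSum_zero_fun]
  simp only [h1, mul_zero, tsum_zero, add_zero, pow_zero, one_mul]
  have h2 : (fun v => rootWeight t (0 :: v)) = fun v => if 0 ∉ v then t ^ dropCount v else 0 := by
    funext v; simp [rootWeight]
  rw [h2]
  convert wordSum_not_mem_zero q k fun v => t ^ dropCount v using 2
  · simp only [dropSum, dropCount_map_succ]

/-- Here `k` is the number of non-root points on the root's cycle. They can be chosen in order in
$m(m-1)\cdots(m-k+1)$ ways, and the factor $(m-k)!$ from the complement completes this to $m!$. -/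
lemma rootedTotal_eq_sum_wordSum {f : ℕ → ℝ≥0∞}
    (hf : ∀ n, total q t (Fin n) = (n.factorial : ℝ≥0∞) * f n) (m : ℕ) (Ψ : List ℕ → ℝ≥0∞) :
    rootedTotal q t (Option (Fin m)) none Ψ = (m.factorial : ℝ≥0∞) *
      ∑ k ∈ Finset.range (m + 1), wordSum q (k + 1) Ψ * f (m - k) := by
  induction m generalizing Ψ with
  | zero =>
    rw [rootedTotal_option, hf]
    simp [wordSum]
  | succ m ih =>
    have h1 : ∀ (y : Fin (m + 1)) (Φ : List ℕ → ℝ≥0∞), rootedTotal q t (Fin (m + 1)) y Φ =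
        rootedTotal q t (Option (Fin m)) none Φ := fun y Φ => by
      rw [← rootedTotal_congr q t (finSuccEquiv' y), finSuccEquiv'_at]
    have h2 : ∀ k, wordSum q (k + 1 + 1) Ψ =
        ∑' a, q ^ a * wordSum q (k + 1) fun v => Ψ (a :: v) := fun k => rfl
    rw [rootedTotal_option, hf, Finset.sum_range_succ']
    simp only [h1, ih, h2, Finset.sum_const, Finset.card_univ, Fintype.card_fin, nsmul_eq_mul,
      Nat.factorial_succ, Nat.cast_mul, mul_add, Nat.add_sub_add_right]
    rw [add_comm]
    congr 1
    · rw [mul_assoc]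
      congr 1
      simp only [← ENNReal.tsum_mul_right]
      rw [← Summable.tsum_finsetSum fun _ _ => ENNReal.summable, ← ENNReal.tsum_mul_left]
      refine tsum_congr fun a => ?_
      simp only [Finset.mul_sum]
      refine Finset.sum_congr rfl fun k _ => ?_
      ring
    · simp only [wordSum, Nat.sub_zero]
      ring

lemma recursion_of_total {f : ℕ → ℝ≥0∞}
    (hf : ∀ n, total q t (Fin n) = (n.factorial : ℝ≥0∞) * f n) (n : ℕ) :
    f (n + 1) = q ^ (n + 1) * f (n + 1) +
      ∑ k ∈ Finset.range (n + 1), q ^ k * dropSum q t k * f (n - k) := by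
  have h := total_eq_add_sum_rooted (α := Fin (n + 1)) q t
  have h1 : ∀ y : Fin (n + 1), rootedTotal q t (Fin (n + 1)) y (rootWeight t) =
      rootedTotal q t (Option (Fin n)) none (rootWeight t) := fun y => by
    rw [← rootedTotal_congr q t (finSuccEquiv' y), finSuccEquiv'_at]
  simp only [h1, rootedTotal_eq_sum_wordSum q t hf, hf, Fintype.card_fin, Finset.sum_const,
    Finset.card_univ, nsmul_eq_mul, wordSum_rootWeight] at h
  have h0 : ((n + 1).factorial : ℝ≥0∞) ≠ 0 := by exact_mod_cast (n + 1).factorial_ne_zero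
  rw [← ENNReal.mul_right_inj h0 (ENNReal.natCast_ne_top _), h, mul_add, Nat.factorial_succ]
  push_cast
  ring

/-- Words are split at their first letter `0`. -/
lemma wordSum_first_zero (k : ℕ) (Ψ : List ℕ → ℝ≥0∞) :
    wordSum q k Ψ = q ^ k * wordSum q k (fun u => Ψ (u.map Nat.succ)) +
      ∑ i ∈ Finset.range k, q ^ i * wordSum q i fun u =>
        wordSum q (k - 1 - i) fun s => Ψ (u.map Nat.succ ++ 0 :: s) := by
  induction k generalizing Ψ with
  | zero => simp [wordSum]
  | succ k ih =>
    rw [wordSum, tsum_nat_split, Finset.sum_range_succ', wordSum]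
    have h1 : ∀ a, q ^ (a + 1) * wordSum q k (fun v => Ψ ((a + 1) :: v)) =
        q ^ (k + 1) * (q ^ a * wordSum q k fun v => Ψ ((a :: v).map Nat.succ)) +
        ∑ i ∈ Finset.range k, q ^ (i + 1) * (q ^ a * wordSum q i fun u =>
          wordSum q (k - 1 - i) fun s => Ψ ((a :: u).map Nat.succ ++ 0 :: s)) := fun a => by
      rw [ih, mul_add, Finset.mul_sum]
      simp only [List.map_cons, List.cons_append, Nat.succ_eq_add_one]
      congr 1
      · ring
      · exact Finset.sum_congr rfl fun i _ => by ring
    simp only [h1]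
    rw [ENNReal.tsum_add, Summable.tsum_finsetSum fun _ _ => ENNReal.summable]
    simp only [ENNReal.tsum_mul_left, pow_zero, one_mul, wordSum, List.map_nil, List.nil_append,
      Nat.add_sub_cancel, Nat.sub_zero]
    have h2 : ∀ i, k - 1 - i = k - (i + 1) := fun i => by omega
    simp only [h2]
    abel

lemma nextSmaller_append_zero {a : ℕ} (u s : List ℕ) :
    nextSmaller (a + 1) (u.map Nat.succ ++ 0 :: s) = nextSmaller a u := by
  induction u with
  | nil => simp [nextSmaller]
  | cons b u ih => simp [nextSmaller, ih]

/-- A 0 lies below every raised letter, so for the part before it the 0 acts as the end of the word.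
-/
lemma dropCount_append_zero (u s : List ℕ) :
    dropCount (u.map Nat.succ ++ 0 :: s) = dropCount u + dropCount (0 :: s) := by
  induction u with
  | nil => simp [dropCount]
  | cons a u ih =>
    rw [List.map_cons, List.cons_append, dropCount, ih, dropCount.eq_2 a u, Nat.succ_eq_add_one,
      nextSmaller_append_zero, add_assoc]

lemma nextSmaller_zero_cons_zero (v : List ℕ) : nextSmaller 0 (0 :: v) = nextSmaller 0 v := by
  simp [nextSmaller]

/-- Nothing is smaller than 0, so a leading 0 counts as a drop only when the rest is all zeros. That
single word contributes $t^{k+1}$ instead of $t^k$; the correction is added on both sides to avoid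
truncated subtraction. -/
lemma wordSum_zero_cons (k : ℕ) :
    wordSum q k (fun s => t ^ dropCount (0 :: s)) + t ^ k = dropSum q t k + t ^ (k + 1) := by
  have h1 : ∀ s, t ^ dropCount (0 :: s) + (if nextSmaller 0 s then t ^ dropCount s else 0) =
      t ^ dropCount s + t * (if nextSmaller 0 s then t ^ dropCount s else 0) := fun s => by
    rw [dropCount]
    split_ifs with h
    · rw [h, Bool.toNat_true, pow_add, pow_one]; ring
    · rw [Bool.eq_false_iff.2 h]; simp
  have h2 : ∀ k, wordSum q k (fun s => if nextSmaller 0 s then t ^ dropCount s else 0) =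
      t ^ k := by
    intro k
    induction k with
    | zero => simp [wordSum, nextSmaller, dropCount]
    | succ k ih =>
      rw [wordSum, tsum_nat_split]
      have h3 : ∀ a, wordSum q k (fun v => if nextSmaller 0 ((a + 1) :: v) then
          t ^ dropCount ((a + 1) :: v) else 0) = 0 := fun a => by
        simp [nextSmaller, wordSum_zero_fun]
      have h4 : (fun v => if nextSmaller 0 (0 :: v) then t ^ dropCount (0 :: v) else 0) =
          fun v => t * if nextSmaller 0 v then t ^ dropCount v else 0 := by
        funext v
        rw [nextSmaller_zero_cons_zero, dropCount]
        split_ifs with h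
        · rw [h, Bool.toNat_true, pow_add, pow_one]
        · rw [mul_zero]
      rw [h4, wordSum_mul_left, ih]
      simp only [h3, mul_zero, tsum_zero, add_zero, pow_zero, one_mul, pow_succ']
  have h5 := congrArg (wordSum q k) (funext h1)
  rw [wordSum_add, wordSum_add, wordSum_mul_left, h2] at h5
  rw [h5, dropSum, pow_succ']

lemma dropSum_recursion (k : ℕ) :
    dropSum q t k + ∑ i ∈ Finset.range k, q ^ i * dropSum q t i * t ^ (k - 1 - i) =
      q ^ k * dropSum q t k +
        ∑ i ∈ Finset.range k, q ^ i * dropSum q t i *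
          (dropSum q t (k - 1 - i) + t ^ (k - 1 - i + 1)) := by
  have h1 : dropSum q t k = q ^ k * dropSum q t k + ∑ i ∈ Finset.range k,
      q ^ i * dropSum q t i * wordSum q (k - 1 - i) fun s => t ^ dropCount (0 :: s) := by
    conv_lhs => rw [dropSum, wordSum_first_zero]
    simp only [dropCount_map_succ, dropCount_append_zero, pow_add, wordSum_mul_left]
    congr 1
    refine Finset.sum_congr rfl fun i _ => ?_
    have := wordSum_mul_left q i (wordSum q (k - 1 - i) fun s => t ^ dropCount (0 :: s))
      fun u => t ^ dropCount u
    simp only [mul_comm (wordSum q (k - 1 - i) fun s => t ^ dropCount (0 :: s))] at this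
    rw [this, ← dropSum]
    ring
  conv_lhs => rw [h1]
  rw [add_assoc, ← Finset.sum_add_distrib]
  congr 1
  refine Finset.sum_congr rfl fun i _ => ?_
  rw [← mul_add, wordSum_zero_cons]

/-- Finiteness allows the recursions to be read in $\mathbb{R}$. The bound replaces every power of
`t` by 1. -/
lemma dropSum_ne_top (hq : q < 1) (ht : t ≤ 1) (k : ℕ) : dropSum q t k ≠ ∞ := by
  have h1 : dropSum q t k ≤ wordSum q k fun _ => 1 :=
    wordSum_mono q fun v => pow_le_one' ht _
  rw [wordSum_one] at h1
  refine ne_top_of_le_ne_top ?_ h1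
  refine ENNReal.pow_ne_top (ENNReal.inv_ne_top.2 ?_)
  exact (tsub_pos_of_lt hq).ne'

end WordSums

/-! ### Solving the $q$-difference equations. -/

section Series

variable {K : Type*} [Field K]

lemma eq_C_of_rescale_eq {q : K} (hq : ∀ n : ℕ, q ^ (n + 1) ≠ 1) {g : K⟦X⟧}
    (hg : rescale q g = g) : g = C (constantCoeff g) := by
  ext n
  obtain _ | n := n
  · simp
  · have h := congrArg (coeff (n + 1)) hg
    rw [coeff_rescale] at h
    have h1 : (q ^ (n + 1) - 1) * coeff (n + 1) g = 0 := by linear_combination h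
    rw [coeff_C, if_neg (Nat.succ_ne_zero n)]
    exact (mul_eq_zero.1 h1).resolve_left (sub_ne_zero.2 (hq n))

lemma mul_inv_of_constantCoeff_one {g : K⟦X⟧} (hg : constantCoeff g = 1) : g * g⁻¹ = 1 :=
  PowerSeries.mul_inv_cancel g (by rw [hg]; exact one_ne_zero)

/-- The solution of the `q`-difference equations for the word and cycle generating functions. -/
lemma series_identity {q t : K} (hq : ∀ n : ℕ, q ^ (n + 1) ≠ 1) {F V H : K⟦X⟧}
    (hF0 : constantCoeff F = 1) (hV0 : constantCoeff V = 1) (hH0 : constantCoeff H = 1)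
    (hF : F = rescale q F + X * rescale q V * F)
    (hV : (1 - C t * X) * V * (1 - X * rescale q V) = (1 - X) * rescale q V)
    (hH : rescale q H = (1 - X) * H) :
    F * (rescale (t * q) H - C (t * q) * H) = C (1 - t * q) * H := by
  have hcc : ∀ (a : K) (g : K⟦X⟧), constantCoeff (rescale a g) = constantCoeff g := fun a g => by
    rw [← coeff_zero_eq_constantCoeff_apply, coeff_rescale, pow_zero, one_mul,
      coeff_zero_eq_constantCoeff_apply]
  have hX : ∀ a : K, rescale a (X : K⟦X⟧) = C a * X := fun a => rescale_X a
  have hC : ∀ a b : K, rescale a (C b : K⟦X⟧) = C b := fun a b => by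
    ext n
    rw [coeff_rescale, coeff_C]
    split_ifs with h <;> simp [h]
  set W := rescale q V
  set T := rescale t H
  set S := rescale (t * q) H with hS
  have hST : S = rescale q T := by rw [hS, ← rescale_rescale]
  have hST' : S = (1 - C t * X) * T := by
    rw [hS, mul_comm, ← rescale_rescale, hH, map_mul, map_sub, map_one, hX]
  have hσS : rescale q S = (1 - C (t * q) * X) * S := by
    nth_rw 1 [hST']
    rw [map_mul, map_sub, map_one, map_mul, hX, hC, ← hST, map_mul]
    ring
  have hVi := mul_inv_of_constantCoeff_one hV0
  have hWi : W * rescale q V⁻¹ = 1 := by rw [← map_mul, hVi, map_one]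
  have hHi := mul_inv_of_constantCoeff_one hH0
  have hJ : (1 - X) * H * rescale q H⁻¹ = 1 := by rw [← hH, ← map_mul, hHi, map_one]
  set Vi := V⁻¹
  set Hi := H⁻¹
  set Wi := rescale q Vi
  set J := rescale q Hi
  have hHJ : Hi = (1 - X) * J := by linear_combination (-Hi) * hJ + (1 - X) * J * hHi
  -- Dividing the quadratic equation by `V * W` makes it linear in the inverse of `V`.
  have hVW : (1 - C t * X) * (Wi - X) = (1 - X) * Vi := by
    linear_combination (Vi * Wi) * hV + ((1 - X) * Vi + (1 - C t * X) * X * (V * Vi)) * hWi -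
      ((1 - C t * X) * (Wi - X)) * hVi
  -- The factor `T * Hi` absorbs the coefficients $1-tz$ and $1-z$ of the linear equation.
  set y := Vi * T * Hi with hy
  have hy' : y = S * J * (Wi - X) := by
    rw [hy, hHJ, hST']
    linear_combination (-T * J) * hVW
  have hσy : rescale q y = Wi * S * J := by
    rw [hy, map_mul, map_mul, ← hST]
  have hT0 : constantCoeff T = 1 := (hcc t H).trans hH0
  have hS0 : constantCoeff S = 1 := (hcc _ H).trans hH0
  have hHi0 : constantCoeff Hi = 1 := by
    have := congrArg constantCoeff hHi
    rwa [map_mul, hH0, one_mul, map_one] at this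
  have hVi0 : constantCoeff Vi = 1 := by
    have := congrArg constantCoeff hVi
    rwa [map_mul, hV0, one_mul, map_one] at this
  have hy0 : constantCoeff y = 1 := by rw [hy, map_mul, map_mul, hT0, hHi0, hVi0]; ring
  -- `F * y` is invariant under $z\mapsto qz$, hence constant because no positive power of $q$ is 1.
  have hFy : F * y = 1 := by
    have hfix : rescale q (F * y) = F * y := by
      rw [map_mul, hσy, hy']
      linear_combination (-Wi * S * J) * hF - (X * F * S * J) * hWi
    rw [eq_C_of_rescale_eq hq hfix, map_mul, hF0, hy0, mul_one, map_one]
  -- The same invariance gives the closed form of `y`; the constant term is $(1-tq)-(1-tq)=0$.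
  have he : C (1 - t * q) * y - (S * Hi - C (t * q)) = 0 := by
    have hfix : rescale q (C (1 - t * q) * y - (S * Hi - C (t * q))) =
        C (1 - t * q) * y - (S * Hi - C (t * q)) := by
      have hC1 : (C (1 - t * q) : K⟦X⟧) = 1 - C (t * q) := by rw [map_sub, map_one]
      have hSH : rescale q (S * Hi) = (1 - C (t * q) * X) * S * J := by rw [map_mul, hσS]
      rw [map_sub (rescale q), map_mul (rescale q) _ y, map_sub (rescale q), hC, hC, hσy, hSH, hy',
        hHJ, hC1]
      ring
    rw [eq_C_of_rescale_eq hq hfix]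
    simp [hy0, hS0, hHi0]
  linear_combination (-F * H) * he - (F * S) * hHi + (C (1 - t * q) * H) * hFy

end Series

/-! ### The identity at real parameters. -/

section Specialize

lemma map_jointPoly {R S : Type*} [CommSemiring R] [CommSemiring S] (φ : R →+* S) (n : ℕ)
    (q t : R) : φ (jointPoly n q t) = jointPoly n (φ q) (φ t) := by
  simp [jointPoly]

lemma map_qFact {R S : Type*} [CommSemiring R] [CommSemiring S] (φ : R →+* S) (n : ℕ)
    (q : R) : φ (qFact q n) = qFact (φ q) n := by
  simp [qFact, qInt]

lemma qFact_succ {R : Type*} [CommSemiring R] (q : R) (n : ℕ) :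
    qFact q (n + 1) = qFact q n * qInt q (n + 1) := by
  rw [qFact, qFact, Finset.prod_Icc_succ_top (by omega)]

lemma jointPoly_zero {R : Type*} [CommSemiring R] (q t : R) : jointPoly 0 q t = 1 := by
  simp [jointPoly, maj, exc, desSet, excSet]

/-- The product `(1 - q) (1 - q²) ⋯ (1 - qⁿ)`. -/
def qPoch (q : ℝ) (n : ℕ) : ℝ := ∏ i : Fin n, (1 - q ^ ((i : ℕ) + 1))

lemma qPoch_succ (q : ℝ) (n : ℕ) : qPoch q (n + 1) = qPoch q n * (1 - q ^ (n + 1)) := by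
  rw [qPoch, Fin.prod_univ_castSucc]
  rfl

lemma qPoch_eq (q : ℝ) (n : ℕ) : qPoch q n = (1 - q) ^ n * qFact q n := by
  induction n with
  | zero => simp [qPoch, qFact]
  | succ n ih =>
    rw [qPoch_succ, ih, qFact_succ, qInt, pow_succ]
    linear_combination (-(1 - q) ^ n * qFact q n) * mul_neg_geom_sum q (n + 1)

variable {q t : NNReal}

lemma one_sub_pow_pos (hq : q < 1) (n : ℕ) : (0 : ℝ) < 1 - (q : ℝ) ^ (n + 1) :=
  sub_pos.2 (pow_lt_one₀ q.2 (by exact_mod_cast hq) (Nat.succ_ne_zero n))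

lemma qPoch_pos (hq : q < 1) (n : ℕ) : 0 < qPoch q n :=
  Finset.prod_pos fun _ _ => one_sub_pow_pos hq _

/-- The normalized labelled sum, as a real number. -/
def normTotal (q t : NNReal) (n : ℕ) : NNReal :=
  jointPoly n q t * ∏ i : Fin n, (1 - q ^ ((i : ℕ) + 1))⁻¹

lemma normTotal_coe (hq : q < 1) (n : ℕ) :
    (normTotal q t n : ℝ) = jointPoly n (q : ℝ) (t : ℝ) / qPoch q n := by
  rw [normTotal, NNReal.coe_mul, NNReal.coe_prod, div_eq_mul_inv, qPoch, ← Finset.prod_inv_distrib]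
  congr 1
  · exact map_jointPoly NNReal.toRealHom n q t
  · refine Finset.prod_congr rfl fun i _ => ?_
    rw [NNReal.coe_inv, NNReal.coe_sub (pow_le_one' hq.le _)]
    simp

lemma total_eq_normTotal (hq : q < 1) (n : ℕ) :
    total q t (Fin n) = (n.factorial : ENNReal) * (normTotal q t n : ENNReal) := by
  rw [total_eq, normTotal, ENNReal.coe_mul]
  congr 2
  · exact (map_jointPoly ENNReal.ofNNRealHom n q t).symm
  · rw [ENNReal.ofNNReal_finsetProd]
    refine Finset.prod_congr rfl fun i _ => ?_
    rw [ENNReal.coe_inv (tsub_pos_of_lt (pow_lt_one₀ (zero_le) hq (Nat.succ_ne_zero _))).ne']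
    simp

lemma joint_series_identity (hq : q < 1) (ht : t ≤ 1) :
    (PowerSeries.mk fun n => jointPoly n (q : ℝ) (t : ℝ) / qPoch q n) *
      (rescale ((t : ℝ) * q) (PowerSeries.mk fun n => 1 / qPoch q n) -
        C ((t : ℝ) * q) * PowerSeries.mk fun n => 1 / qPoch q n) =
      C (1 - (t : ℝ) * q) * PowerSeries.mk fun n => 1 / qPoch q n := by
  obtain ⟨v, hv⟩ : ∃ v : ℕ → NNReal, ∀ k, dropSum q t k = v k :=
    ⟨fun k => (dropSum q t k).toNNReal, fun k =>
      (ENNReal.coe_toNNReal (dropSum_ne_top q t (by exact_mod_cast hq)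
        (by exact_mod_cast ht) k)).symm⟩
  have hrec := recursion_of_total q t (f := fun n => (normTotal q t n : ENNReal))
    (total_eq_normTotal hq)
  have hrec' := dropSum_recursion q t
  simp only [hv] at hrec hrec'
  have hF : ∀ n, (normTotal q t (n + 1) : ℝ) = (q : ℝ) ^ (n + 1) * normTotal q t (n + 1) +
      ∑ k ∈ Finset.range (n + 1), (q : ℝ) ^ k * v k * normTotal q t (n - k) := by
    intro n
    have := hrec n
    exact_mod_cast this
  have hV : ∀ k, (v k : ℝ) + ∑ i ∈ Finset.range k, (q : ℝ) ^ i * v i * (t : ℝ) ^ (k - 1 - i) =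
      (q : ℝ) ^ k * v k + ∑ i ∈ Finset.range k, (q : ℝ) ^ i * v i *
        (v (k - 1 - i) + (t : ℝ) ^ (k - 1 - i + 1)) := by
    intro k
    have := hrec' k
    exact_mod_cast this
  have hv0 : v 0 = 1 := by
    have : ((v 0 : NNReal) : ENNReal) = 1 := by
      rw [← hv, dropSum, wordSum, dropCount, pow_zero]
    exact_mod_cast this
  have hcoeff : ∀ (n : ℕ) (g : ℝ⟦X⟧), coeff (n + 1) (X * g) = coeff n g := fun n g =>
    coeff_succ_X_mul n g
  have hsum : ∀ (n : ℕ) (a b : ℕ → ℝ), coeff n (PowerSeries.mk a * PowerSeries.mk b) =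
      ∑ k ∈ Finset.range (n + 1), a k * b (n - k) := fun n a b => by
    rw [coeff_mul, Finset.Nat.sum_antidiagonal_eq_sum_range_succ
      (fun i j => coeff i (PowerSeries.mk a) * coeff j (PowerSeries.mk b))]
    simp
  have hres : ∀ (c : ℝ) (a : ℕ → ℝ), rescale c (PowerSeries.mk a) =
      PowerSeries.mk fun n => c ^ n * a n := fun c a => by
    ext n; simp
  set V : ℝ⟦X⟧ := PowerSeries.mk fun k => (v k : ℝ) with hVdef
  set F : ℝ⟦X⟧ := PowerSeries.mk fun n => (normTotal q t n : ℝ) with hFdef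
  have hF1 : (PowerSeries.mk fun n => jointPoly n (q : ℝ) (t : ℝ) / qPoch q n) = F := by
    rw [hFdef]
    congr 1
    funext n
    rw [normTotal_coe hq]
  rw [hF1]
  refine series_identity (V := V) (fun n => ?_) ?_ ?_ ?_ ?_ ?_ ?_
  · have := one_sub_pow_pos hq n
    linarith
  · rw [hFdef, ← coeff_zero_eq_constantCoeff_apply, coeff_mk, normTotal_coe hq, jointPoly_zero]
    simp [qPoch]
  · rw [hVdef, ← coeff_zero_eq_constantCoeff_apply, coeff_mk, hv0]
    rfl
  · rw [← coeff_zero_eq_constantCoeff_apply, coeff_mk]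
    simp [qPoch]
  · ext n
    rw [map_add, mul_assoc]
    obtain _ | n := n
    · simp [hFdef]
    · rw [hcoeff, coeff_rescale, hVdef, hres, hFdef, hsum, coeff_mk]
      exact hF n
  · set G : ℝ⟦X⟧ := PowerSeries.mk fun n => (t : ℝ) ^ n with hG
    -- `G` is the geometric series $1/(1-tz)$; multiplying by $1-tz$ clears the powers of $t$ from
    -- the word recursion.
    have hG1 : (1 - C (t : ℝ) * X) * G = 1 := by
      ext n
      rw [sub_mul, one_mul, map_sub, mul_assoc, coeff_C_mul]
      obtain _ | n := n
      · simp [hG]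
      · rw [hcoeff, hG, coeff_mk, coeff_mk, coeff_one, if_neg (Nat.succ_ne_zero n), pow_succ']
        ring
    have hV2 : V + X * (rescale (q : ℝ) V * G) =
        rescale (q : ℝ) V + X * (rescale (q : ℝ) V * (V + C (t : ℝ) * G)) := by
      have hVG : V + C (t : ℝ) * G = PowerSeries.mk fun n => (v n : ℝ) + (t : ℝ) ^ (n + 1) := by
        ext n
        simp [hVdef, hG, coeff_C_mul, pow_succ']
      rw [hVG, hVdef, hres, hG]
      ext n
      rw [map_add, map_add]
      obtain _ | n := n
      · simp
      · rw [hcoeff, hcoeff, hsum, hsum, coeff_mk, coeff_mk]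
        exact hV (n + 1)
    linear_combination (1 - C (t : ℝ) * X) * hV2 +
      (rescale (q : ℝ) V * X * (C (t : ℝ) - 1)) * hG1
  · ext n
    rw [sub_mul, one_mul, map_sub, coeff_rescale]
    obtain _ | n := n
    · simp
    · rw [hcoeff, coeff_mk, coeff_mk, qPoch_succ]
      have h1 := (qPoch_pos hq n).ne'
      have h2 := (one_sub_pow_pos hq n).ne'
      field_simp
      ring

/-- The generating function identity at real parameters. -/
lemma real_identity (hq : q < 1) (ht : t ≤ 1) :
    (PowerSeries.mk fun n => jointPoly n (q : ℝ) (t : ℝ) / qFact (q : ℝ) n) *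
      (rescale ((t : ℝ) * q) (expq (q : ℝ)) - C ((t : ℝ) * q) * expq (q : ℝ)) =
      C (1 - (t : ℝ) * q) * expq (q : ℝ) := by
  -- Replacing $z$ by $(1-q)z$ turns $\prod_{i\le n}(1-q^i)=(1-q)^n[n]_q!$ into $[n]_q!$.
  have h := congrArg (rescale (1 - (q : ℝ))) (joint_series_identity hq ht)
  have hne : (1 - (q : ℝ)) ≠ 0 := by
    have := one_sub_pow_pos hq 0
    rw [zero_add, pow_one] at this
    exact this.ne'
  have hres : ∀ a : ℕ → ℝ, rescale (1 - (q : ℝ)) (PowerSeries.mk fun n => a n / qPoch q n) =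
      PowerSeries.mk fun n => a n / qFact (q : ℝ) n := fun a => by
    ext n
    rw [coeff_rescale, coeff_mk, coeff_mk, qPoch_eq]
    field_simp
  have hC : ∀ b : ℝ, rescale (1 - (q : ℝ)) (C b) = C b := fun b => by
    ext n
    rw [coeff_rescale, coeff_C]
    split_ifs with h <;> simp [h]
  have hE : rescale (1 - (q : ℝ)) (PowerSeries.mk fun n => 1 / qPoch q n) = expq (q : ℝ) :=
    hres fun _ => 1
  rw [map_mul (rescale _), map_mul (rescale _), map_sub (rescale _), map_mul (rescale _), hC, hC,
    hres, hE, rescale_rescale, mul_comm ((t : ℝ) * q) (1 - (q : ℝ)), ← rescale_rescale, hE] at h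
  exact h

end Specialize

/-! ### Transfer to $\mathbb{Q}(q,t)$. -/

section Transfer

/-- Only countably many reals are algebraic over a countable ring, while the interval is
uncountable. -/
lemma exists_transcendental_Ioo (A : Subalgebra ℚ ℝ) [Countable A] :
    ∃ a ∈ Set.Ioo (0 : ℝ) 1, Transcendental A a := by
  by_contra! h
  have hc : (Set.Ioo (0 : ℝ) 1).Countable :=
    (Algebraic.countable A ℝ).mono fun a ha => by
      have := h a ha
      rwa [Transcendental, not_not] at this
  rw [Cardinal.Real.Ioo_countable_iff] at hc
  exact absurd hc (by norm_num)

/-- First `q` is taken transcendental over the rationals, then `t` transcendental over the countable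
ring generated by `q`. -/
lemma exists_algebraicIndependent_Ioo :
    ∃ q ∈ Set.Ioo (0 : ℝ) 1, ∃ t ∈ Set.Ioo (0 : ℝ) 1, AlgebraicIndependent ℚ ![q, t] := by
  have hcount : ∀ s : Set ℝ, s.Countable → Countable (Algebra.adjoin ℚ s) := fun s hs => by
    rw [← Cardinal.mk_le_aleph0_iff]
    refine (Algebra.cardinalMk_adjoin_le ℚ s).trans ?_
    simp [hs]
  have := hcount ∅ Set.countable_empty
  obtain ⟨q, hq, hq'⟩ := exists_transcendental_Ioo (Algebra.adjoin ℚ (∅ : Set ℝ))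
  have hq1 : AlgebraicIndependent ℚ fun _ : Fin 1 => q := by
    rw [algebraicIndependent_unique_type_iff]
    exact hq'.restrictScalars (algebraMap ℚ _).injective
  have := hcount (Set.range fun _ : Fin 1 => q) (Set.countable_range _)
  obtain ⟨t, ht, ht'⟩ := exists_transcendental_Ioo (Algebra.adjoin ℚ (Set.range fun _ : Fin 1 => q))
  refine ⟨q, hq, t, ht, ?_⟩
  have h := AlgebraicIndependent.option_iff.2 ⟨hq1, ht'⟩
  rw [← algebraicIndependent_equiv (finSuccEquiv' (1 : Fin 2))] at h
  convert h using 1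
  funext i
  fin_cases i <;> rfl

/-- The field of rational functions embeds into the reals, with the indeterminates in `(0, 1)`. -/
lemma exists_ringHom_real : ∃ (q t : NNReal) (φ : RatQT →+* ℝ), q < 1 ∧ t < 1 ∧
    φ qVar = q ∧ φ tVar = t := by
  obtain ⟨q, hq, t, ht, h⟩ := exists_algebraicIndependent_Ioo
  have hinj : Function.Injective
      (MvPolynomial.aeval ![q, t] : MvPolynomial (Fin 2) ℚ →ₐ[ℚ] ℝ).toRingHom := h
  refine ⟨⟨q, hq.1.le⟩, ⟨t, ht.1.le⟩, IsFractionRing.lift hinj, hq.2, ht.2, ?_, ?_⟩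
  · rw [qVar, IsFractionRing.lift_algebraMap]
    simp only [AlgHom.toRingHom_eq_coe, RingHom.coe_coe, MvPolynomial.aeval_X]
    rfl
  · rw [tVar, IsFractionRing.lift_algebraMap]
    simp only [AlgHom.toRingHom_eq_coe, RingHom.coe_coe, MvPolynomial.aeval_X]
    rfl

lemma map_expq {K L : Type*} [Field K] [Field L] (φ : K →+* L) (q : K) :
    PowerSeries.map φ (expq q) = expq (φ q) := by
  ext n
  simp [expq, map_qFact]

lemma qFact_pos (q : NNReal) (n : ℕ) : (0 : ℝ) < qFact (q : ℝ) n := by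
  refine Finset.prod_pos fun j hj => ?_
  have : 0 < j := (Finset.mem_Icc.1 hj).1
  obtain ⟨m, rfl⟩ := Nat.exists_eq_succ_of_ne_zero this.ne'
  rw [qInt, Finset.sum_range_succ', pow_zero]
  positivity

end Transfer

end MajExc

end

/-- The identity of formal power series in `z` over `ℚ(q, t)`. The first two conjuncts say that the
divisions by `[n]_q!` and by the power series in the denominator are genuine. -/
theorem theorem1p1 :
    (∀ n : ℕ, MajExc.qFact MajExc.qVar n ≠ 0) ∧
    IsUnit (PowerSeries.rescale (MajExc.tVar * MajExc.qVar) (MajExc.expq MajExc.qVar) -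
      PowerSeries.C (MajExc.tVar * MajExc.qVar) * MajExc.expq MajExc.qVar) ∧
    PowerSeries.mk (fun n : ℕ =>
        MajExc.jointPoly n MajExc.qVar MajExc.tVar / MajExc.qFact MajExc.qVar n) =
      PowerSeries.C (1 - MajExc.tVar * MajExc.qVar) * MajExc.expq MajExc.qVar *
        (PowerSeries.rescale (MajExc.tVar * MajExc.qVar) (MajExc.expq MajExc.qVar) -
          PowerSeries.C (MajExc.tVar * MajExc.qVar) * MajExc.expq MajExc.qVar)⁻¹ := by
  obtain ⟨q, t, φ, hq, ht, hφq, hφt⟩ := MajExc.exists_ringHom_real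
  have h1 : ∀ n : ℕ, MajExc.qFact MajExc.qVar n ≠ 0 := fun n h => by
    have h2 := congrArg φ h
    rw [MajExc.map_qFact, hφq, map_zero] at h2
    exact (MajExc.qFact_pos q n).ne' h2
  have h0 : PowerSeries.constantCoeff (MajExc.expq MajExc.qVar) = 1 := by
    rw [← PowerSeries.coeff_zero_eq_constantCoeff_apply, MajExc.expq, PowerSeries.coeff_mk]
    simp [MajExc.qFact]
  have h2 : PowerSeries.constantCoeff
      (PowerSeries.rescale (MajExc.tVar * MajExc.qVar) (MajExc.expq MajExc.qVar) -
        PowerSeries.C (MajExc.tVar * MajExc.qVar) * MajExc.expq MajExc.qVar) ≠ 0 := by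
    intro h
    rw [map_sub, map_mul PowerSeries.constantCoeff, PowerSeries.constantCoeff_C, h0,
      ← PowerSeries.coeff_zero_eq_constantCoeff_apply, PowerSeries.coeff_rescale,
      PowerSeries.coeff_zero_eq_constantCoeff_apply, h0] at h
    -- The constant term is $1-tq$, and its real image is positive since $tq<1$.
    have h3 := congrArg φ h
    simp only [map_sub, map_mul, map_one, pow_zero, mul_one, hφq, hφt, map_zero] at h3
    have h4 : t * q < 1 := mul_lt_one_of_nonneg_of_lt_one_left (zero_le) ht hq.le
    have h5 : (t : ℝ) * q < 1 := by exact_mod_cast h4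
    linarith
  refine ⟨h1, PowerSeries.isUnit_iff_constantCoeff.2 h2.isUnit, ?_⟩
  rw [PowerSeries.eq_mul_inv_iff_mul_eq h2]
  -- With the denominator cleared, the identity can be checked after the embedding into the reals.
  refine PowerSeries.map_injective φ φ.injective ?_
  have hmk : PowerSeries.map φ (PowerSeries.mk fun n : ℕ =>
      MajExc.jointPoly n MajExc.qVar MajExc.tVar / MajExc.qFact MajExc.qVar n) =
      PowerSeries.mk fun n => MajExc.jointPoly n (q : ℝ) (t : ℝ) / MajExc.qFact (q : ℝ) n := by
    ext n
    simp [MajExc.map_jointPoly, MajExc.map_qFact, hφq, hφt]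
  have hE : PowerSeries.map φ (MajExc.expq MajExc.qVar) = MajExc.expq (q : ℝ) := by
    rw [MajExc.map_expq, hφq]
  have hC : ∀ x, PowerSeries.map φ (PowerSeries.C x) = PowerSeries.C (φ x) :=
    PowerSeries.map_C φ
  have htq : φ (MajExc.tVar * MajExc.qVar) = (t : ℝ) * q := by rw [map_mul, hφt, hφq]
  have htq' : φ (1 - MajExc.tVar * MajExc.qVar) = 1 - (t : ℝ) * q := by
    rw [map_sub, map_one, htq]
  rw [map_mul (PowerSeries.map φ), map_mul (PowerSeries.map φ), map_sub (PowerSeries.map φ),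
    map_mul (PowerSeries.map φ), hmk, hC, hC, hE, ← PowerSeries.rescale_map, hE, htq, htq']
  exact MajExc.real_identity hq ht.le
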